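/- Let $0<\alpha\le 2$. For $c,\xi\in\mathbb C$ and $\sigma>0$ let $a=(a_0,a_1)$ be a random vector of complex data with signal $s_k=c\,\xi^{k}$, $k=0,1$, and spherical $\alpha$-stable noise: the real vector $\tilde a=(\Re a,\Im a)\in\mathbb R^4$ has the elliptical density $$G(x)=\frac{1}{2\pi^2}\,(\det\Sigma)^{-1/2}\,r^{-3}g(r),\qquad r=\big((x-\tilde s)^T\Sigma^{-1}(x-\tilde s)\big)^{1/2},\qquad \tilde s=(\Re s,\Im s),\quad \Sigma=\tfrac{\sigma^2}{2}I_4,$$ where $g$ is the density of $\frac{\sqrt2}{\sigma}|\tilde a-\tilde s|$, and it is $\alpha$-stable with characteristic function $\exp\big(i\langle t,\tilde s\rangle-(\tfrac12 t^T\Sigma t)^{\alpha/2}\big)$. Let $\rho=|c|^2/\sigma^2$ be the signal-to-noise ratio. (1) Almost surely the Hankel pencil $[a_1,a_0]$ has exactly one generalized eigenvalue, the pole $a_1/a_0$ of the Padé approximant of order $[0,1]$. The pole has a continuous density $h(\cdot,\rho,\xi)$ on $\mathbb C$ that depends only on $\alpha,\rho,\xi$. As $\rho\to0$ and $|\xi|\to1$,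 this density agrees to first order in $\rho$ with the spherical density $$\tilde h(z,\rho)=\frac{1}{\pi\big(1+|z-\rho\,\Gamma(1+\frac2\alpha)\,\xi|^2\big)^2}.$$ That is, there is a constant $C$ depending only on $\alpha$ such that, for all sufficiently small $\rho\ge0$ and all $\xi$ with $|\xi|$ sufficiently close to $1$, $$|h(z,\rho,\xi)-\tilde h(z,\rho)|\le C\rho\,\big(\rho+\big||\xi|-1\big|\big)\qquad\text{for all } z\in\mathbb C .$$ (2) For all $\rho\in\mathbb R$ and $\xi\in\mathbb C$, $\tilde h(\cdot,\rho)$ is the elliptical density on $\mathbb C\cong\mathbb R^2$ with centre $m=\rho\,\Gamma(1+\frac2\alpha)\,\xi$, scatter matrix $I_2$ and radial function $f(r)=\frac1{(1+r^2)^2}$: under $\tilde h$ the distance $|z-m|$ has density $\frac{r}{\nu_1}f(r)$ on $(0,\infty)$, where $\nu_1=\int_0^\infty r f(r)\,dr$, and $\tilde h(z,\rho)=\frac1{2\pi|z-m|}\cdot\frac{|z-m|}{\nu_1}f(|z-m|)$ for almost every $z$. (3) The first moment of $f$ is finite, $\nu_1=\frac12$. The function $f^{1/2}$ is differentiable and $(f^{1/2})'\in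 L^2((0,\infty),r\,dr)$. Hence the assumptions of Hallin and Paindaveine on the radial function $f$ in dimension $2$ hold: (A1) $f>0$ almost everywhere on $(0,\infty)$ and $\int_0^\infty r f(r)\,dr<\infty$; (A2') $f^{1/2}$ belongs to the Sobolev space $W^{1,2}$ of $(0,\infty)$ with weight $r$. -/

import Mathlib

open MeasureTheory Set Filter Topology
open scoped Real

noncomputable section

/-- The real vector `(Re a, Im a)` of a complex vector `a`. -/
def reIm {n : ℕ} (a : Fin n → ℂ) : EuclideanSpace ℝ (Fin n ⊕ Fin n) :=
  WithLp.toLp 2 (Sum.elim (fun k => (a k).re) (fun k => (a k).im))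

section Elliptical

variable {ι : Type*} [Fintype ι] [DecidableEq ι]

/-- `((x - s)ᵀ Σ⁻¹ (x - s))^{1/2}`. -/
def mahalanobis (s : EuclideanSpace ℝ ι) (S : Matrix ι ι ℝ) (x : EuclideanSpace ℝ ι) : ℝ :=
  Real.sqrt (dotProduct (x - s).ofLp (S⁻¹.mulVec (x - s).ofLp))

/-- The elliptical density on `ℝ^d`, `d = |ι|`, with location `s`, scatter matrix `Σ`, and density
`g` of the normalized distance `r = ((x - s)ᵀ Σ⁻¹ (x - s))^{1/2}` to the location:
`Γ(d/2) / (2 π^{d/2}) · (det Σ)^{-1/2} · r^{1-d} · g(r)`. -/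
def ellipticalDensity (s : EuclideanSpace ℝ ι) (S : Matrix ι ι ℝ) (g : ℝ → ℝ)
    (x : EuclideanSpace ℝ ι) : ℝ :=
  Real.Gamma ((Fintype.card ι : ℝ) / 2) / (2 * π ^ ((Fintype.card ι : ℝ) / 2))
    * (Real.sqrt S.det)⁻¹
    * (mahalanobis s S x) ^ (1 - (Fintype.card ι : ℤ)) * g (mahalanobis s S x)

/-- The measure `P` on `ℝ^d` is the elliptical distribution with location `s`, scatter matrix `S`
and density `g` of the normalized distance to the location. -/
structure IsElliptical (s : EuclideanSpace ℝ ι) (S : Matrix ι ι ℝ) (g : ℝ → ℝ)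
    (P : Measure (EuclideanSpace ℝ ι)) : Prop where
  posDef : S.PosDef
  measurable : Measurable g
  nonneg : ∀ r, 0 < r → 0 ≤ g r
  distance_law : P.map (mahalanobis s S)
    = (volume.restrict (Ioi 0)).withDensity (fun r => ENNReal.ofReal (g r))
  density : P = volume.withDensity (fun x => ENNReal.ofReal (ellipticalDensity s S g x))

/-- The measure `P` on `ℝ^d` is the elliptically contoured `α`-stable law with location `s` and
scatter matrix `S`: its characteristic function is `exp(i⟨t,s⟩ - (tᵀ S t / 2)^{α/2})`. For `α = 2`
this is the Gaussian law with mean `s` and covariance matrix `S`. -/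
def IsStable (α : ℝ) (s : EuclideanSpace ℝ ι) (S : Matrix ι ι ℝ)
    (P : Measure (EuclideanSpace ℝ ι)) : Prop :=
  ∀ t : EuclideanSpace ℝ ι, charFun P t
    = Complex.exp (((inner ℝ t s : ℝ) : ℂ) * Complex.I
        - (((dotProduct t.ofLp (S.mulVec t.ofLp) / 2) ^ (α / 2) : ℝ) : ℂ))

end Elliptical

/-- The Hankel matrix `U₀ = (a_{i+j})`, `0 ≤ i, j < p`. -/
def hankelZero {p : ℕ} (a : Fin (2 * p) → ℂ) : Matrix (Fin p) (Fin p) ℂ :=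
  Matrix.of fun i j => a ⟨i + j, by omega⟩

/-- The Hankel matrix `U₁ = (a_{i+j+1})`, `0 ≤ i, j < p`. -/
def hankelOne {p : ℕ} (a : Fin (2 * p) → ℂ) : Matrix (Fin p) (Fin p) ℂ :=
  Matrix.of fun i j => a ⟨i + j + 1, by omega⟩

/-- The generalized eigenvalues of the Hankel pencil `[U₁, U₀]`, that is, the poles of the Padé
approximant of order `[p-1,p]` of the `Z`-transform. -/
def padePoles {p : ℕ} (a : Fin (2 * p) → ℂ) : Set ℂ :=
  {z | (hankelOne a - z • hankelZero a).det = 0}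

/-- The spherical density `1 / (π (1 + |z - ρ Γ(1+2/α) ξ|²)²)`. -/
def sphericalApprox (α ρ : ℝ) (ξ z : ℂ) : ℝ :=
  1 / (π * (1 + ‖z - ((ρ * Real.Gamma (1 + 2 / α) : ℝ) : ℂ) * ξ‖ ^ 2) ^ 2)

/-- `ν_k = ∫₀^∞ r^k f(r) dr`. -/
def radialMoment (k : ℕ) (f : ℝ → ℝ) : ℝ := ∫ r in Ioi (0 : ℝ), r ^ k * f r

/-- The density `r^{d-1} f(r) / ν_{d-1}` of the normalized distance to the location which, in
dimension `d`, corresponds to the radial function `f`. -/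
def distanceDensity (d : ℕ) (f : ℝ → ℝ) (r : ℝ) : ℝ :=
  r ^ (d - 1) / radialMoment (d - 1) f * f r

/-- Lebesgue measure on `(0,∞)` with weight `r^k`. -/
def weightedMeasure (k : ℕ) : Measure ℝ :=
  (volume.restrict (Ioi (0 : ℝ))).withDensity (fun r => ENNReal.ofReal (r ^ k))

/-- `v` is a weak derivative of `u` on `(0,∞)`. -/
def IsWeakDerivOnPos (u v : ℝ → ℝ) : Prop :=
  ∀ ψ : ℝ → ℝ, ContDiff ℝ ((⊤ : ℕ∞) : WithTop ℕ∞) ψ → HasCompactSupport ψ → tsupport ψ ⊆ Ioi 0 →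
    ∫ r in Ioi (0 : ℝ), u r * deriv ψ r = - ∫ r in Ioi (0 : ℝ), v r * ψ r

/-- Assumption (A1) of Hallin and Paindaveine on a radial function in dimension `d`: `f > 0` almost everywhere on `(0,∞)`
and `ν_{d-1} = ∫₀^∞ r^{d-1} f(r) dr` is finite. -/
def AssumptionA1 (d : ℕ) (f : ℝ → ℝ) : Prop :=
  (∀ᵐ r ∂(volume.restrict (Ioi (0 : ℝ))), 0 < f r) ∧
    IntegrableOn (fun r => r ^ (d - 1) * f r) (Ioi 0)

/-- Assumption (A2') of Hallin and Paindaveine on a radial function in dimension `d`: `f^{1/2}` belongs to the Sobolev space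
`W^{1,2}` of `(0,∞)` with weight `r^{d-1}`. -/
def AssumptionA2' (d : ℕ) (f : ℝ → ℝ) : Prop :=
  MemLp (fun r => Real.sqrt (f r)) 2 (weightedMeasure (d - 1)) ∧
    ∃ v : ℝ → ℝ, IsWeakDerivOnPos (fun r => Real.sqrt (f r)) v ∧
      MemLp v 2 (weightedMeasure (d - 1))

/-- The function `f(r) = 1 / (1 + r²)²`. -/
def poleRadial (r : ℝ) : ℝ := 1 / (1 + r ^ 2) ^ 2

end

/-!
Write the law of the data as a spherical density `G (|x₁ - c|² + |x₂ - c ξ|²)` on `ℂ²`, and put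
`N = 1 + |z|²`. The density at `z` of the quotient `x₂ / x₁` is the integral of `|w|² G` over the
complex line of the points `(w, z w)`. Completing the square along that line, dropping the mixed
term by symmetry and passing to polar coordinates turns it into
`N⁻² (∫_{l > k} T l dl + κ T k)`, with `k = |c|² D`, `κ = |c|² u`, where `D` and `u` are the squared
distance of `(1, ξ)` from the line and the squared norm of its projection to the line, and
`T l = π ∫_{y > l} G y dy` (`lintegral_line`, `map_div_withDensity`).

The function `T` is also the density of the single datum `x₁`, at squared distance `l` from `c`. It
is continuous on `(0, ∞)`, and the characteristic function `exp (i⟨t, c⟩ - (σ |t| / 2) ^ α)` of `x₁`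
is integrable, so that Fourier inversion gives `T l = σ⁻² q (l / σ²)` with a function `q` that
depends only on `α` (`planarMarginal_eq_stablePlanarDensity`). As `∫_{l > 0} T l dl = 1 / π`, the
pole has the density `N⁻² (1 / π - ∫_0^{ρ D} q + ρ u q (ρ D))`
(`map_div_eq_withDensity_poleDensity`).

The function `q` is bounded, `q 0 = Γ (1 + 2 / α) / π` is an elementary integral, and
`|q k - q 0| ≤ L k` because the second moment of `exp (-(π |t|) ^ α)` is finite. Hence the density
is `(π N²)⁻¹ (1 + ρ Γ (1 + 2 / α) (u - D))` up to `O (ρ²)`, uniformly in `z`. Finally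
`u - D = (4 Re (conj z ξ) + (1 - |z|²) (1 - |ξ|²)) / N`, and the part of it that survives for
`|ξ| = 1` is the first order term of the expansion of `(1 + |z - m|²)⁻²` in its centre `m`.
-/

noncomputable section

/-! ### Radial integrals and the identification of complex and real vectors -/

theorem lintegral_comp_norm {f : ℝ → ENNReal} (hf : Measurable f) :
    ∫⁻ v : ℂ, f ‖v‖ = ENNReal.ofReal (2 * π) * ∫⁻ r in Ioi (0 : ℝ), ENNReal.ofReal r * f r := by
  rw [← Complex.lintegral_comp_polarCoord_symm, polarCoord_target, Measure.volume_eq_prod,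
    setLIntegral_prod, ← lintegral_const_mul _ (by fun_prop)]
  · refine setLIntegral_congr_fun measurableSet_Ioi fun r hr => ?_
    have hr' : (0 : ℝ) < r := hr
    have hn : ∀ θ : ℝ, ‖Complex.polarCoord.symm (r, θ)‖ = r := by
      intro θ
      rw [Complex.norm_polarCoord_symm, abs_of_pos hr']
    simp only [hn, smul_eq_mul, lintegral_const, Measure.restrict_apply_univ, Real.volume_Ioo]
    rw [mul_comm, show π - -π = 2 * π by ring]
  · apply Measurable.aemeasurable
    simp only [Complex.norm_polarCoord_symm, smul_eq_mul]
    fun_prop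

/-- Polar coordinates in `ℂ`, with the squared modulus as the radial variable. -/
theorem lintegral_comp_norm_sq {f : ℝ → ENNReal} (hf : Measurable f) :
    ∫⁻ v : ℂ, f (‖v‖ ^ 2) = ENNReal.ofReal π * ∫⁻ t in Ioi (0 : ℝ), f t := by
  have himg : (fun r : ℝ => r ^ 2) '' Ioi 0 = Ioi 0 := by
    ext t
    constructor
    · rintro ⟨r, hr, rfl⟩
      exact mem_Ioi.2 (pow_pos (mem_Ioi.1 hr) 2)
    · intro ht
      exact ⟨√t, Real.sqrt_pos.2 ht, Real.sq_sqrt (le_of_lt ht)⟩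
  have hsub : ∫⁻ t in Ioi (0 : ℝ), f t
      = ∫⁻ r in Ioi (0 : ℝ), ENNReal.ofReal |2 * r| * f (r ^ 2) := by
    rw [← lintegral_image_eq_lintegral_abs_deriv_mul (f := fun r : ℝ => r ^ 2) (g := f)
      measurableSet_Ioi, himg]
    · intro x _
      simpa using (hasDerivAt_pow 2 x).hasDerivWithinAt
    · intro x hx y hy hxy
      exact (pow_left_inj₀ (le_of_lt hx) (le_of_lt hy) two_ne_zero).1 hxy
  rw [lintegral_comp_norm (f := fun r => f (r ^ 2)) (by fun_prop), hsub,
    ← lintegral_const_mul _ (by fun_prop), ← lintegral_const_mul _ (by fun_prop)]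
  refine setLIntegral_congr_fun measurableSet_Ioi fun r hr => ?_
  have hr' : (0 : ℝ) < r := hr
  rw [abs_of_pos (by positivity), ← mul_assoc, ← mul_assoc, ← ENNReal.ofReal_mul (by positivity),
    ← ENNReal.ofReal_mul Real.pi_pos.le]
  congr 2
  ring

/-- `reIm` as a measurable equivalence. -/
def reImEquiv (n : ℕ) : (Fin n → ℂ) ≃ᵐ EuclideanSpace ℝ (Fin n ⊕ Fin n) :=
  (((MeasurableEquiv.piCongrRight fun _ => Complex.measurableEquivRealProd).trans
    (MeasurableEquiv.arrowProdEquivProdArrow ℝ ℝ (Fin n))).trans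
    (MeasurableEquiv.sumPiEquivProdPi fun _ : Fin n ⊕ Fin n => ℝ).symm).trans
    (MeasurableEquiv.toLp 2 _)

theorem coe_reImEquiv (n : ℕ) : ⇑(reImEquiv n) = reIm := by
  funext a
  ext i
  rcases i with i | i <;> rfl

theorem measurePreserving_reIm (n : ℕ) :
    MeasurePreserving (reIm : (Fin n → ℂ) → EuclideanSpace ℝ (Fin n ⊕ Fin n)) := by
  rw [← coe_reImEquiv]
  have h1 : MeasurePreserving (MeasurableEquiv.piCongrRight
      fun _ : Fin n => Complex.measurableEquivRealProd) :=
    volume_preserving_pi fun _ => Complex.volume_preserving_equiv_real_prod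
  have h2 := volume_measurePreserving_arrowProdEquivProdArrow ℝ ℝ (Fin n)
  have h3 := (volume_measurePreserving_sumPiEquivProdPi fun _ : Fin n ⊕ Fin n => ℝ).symm
  have h4 := PiLp.volume_preserving_toLp (Fin n ⊕ Fin n)
  exact h4.comp (h3.comp (h2.comp h1))

theorem norm_reIm_sub_sq {n : ℕ} (a b : Fin n → ℂ) :
    ‖reIm a - reIm b‖ ^ 2 = ∑ k, ‖a k - b k‖ ^ 2 := by
  rw [EuclideanSpace.norm_sq_eq, Fintype.sum_sum_type, ← Finset.sum_add_distrib]
  refine Finset.sum_congr rfl fun k _ => ?_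
  rw [Complex.sq_norm, Complex.normSq_apply]
  simp [reIm, ← sq]

/-- A density transported along a measure preserving equivalence. -/
theorem map_withDensity_of_measurePreserving {X Y : Type*} [MeasurableSpace X] [MeasurableSpace Y]
    {μ : Measure X} {ν : Measure Y} (e : X ≃ᵐ Y) (he : MeasurePreserving e μ ν) {f : Y → ENNReal} :
    (μ.withDensity fun x => f (e x)).map e = ν.withDensity f := by
  ext s hs
  rw [e.map_apply, withDensity_apply _ (e.measurable hs), withDensity_apply _ hs,
    he.setLIntegral_comp_preimage_emb e.measurableEmbedding]

/-! ### The law of a quotient under a spherical density -/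

/-- The squared distance of `(1, ξ)` from the complex line spanned by `(1, z)`. -/
def lineDist (ξ z : ℂ) : ℝ := ‖z - ξ‖ ^ 2 / (1 + ‖z‖ ^ 2)

/-- The squared norm of the orthogonal projection of `(1, ξ)` to the complex line spanned by
`(1, z)`. -/
def lineProj (ξ z : ℂ) : ℝ := ‖1 + (starRingEnd ℂ) z * ξ‖ ^ 2 / (1 + ‖z‖ ^ 2)

theorem lineDist_nonneg (ξ z : ℂ) : 0 ≤ lineDist ξ z := by unfold lineDist; positivity

theorem lineProj_nonneg (ξ z : ℂ) : 0 ≤ lineProj ξ z := by unfold lineProj; positivity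

theorem lineDist_add_lineProj (ξ z : ℂ) : lineDist ξ z + lineProj ξ z = 1 + ‖ξ‖ ^ 2 := by
  unfold lineDist lineProj
  rw [← add_div, div_eq_iff (by positivity)]
  simp only [Complex.sq_norm, Complex.normSq_apply, Complex.sub_re, Complex.sub_im, Complex.add_re,
    Complex.add_im, Complex.mul_re, Complex.mul_im, Complex.conj_re, Complex.conj_im,
    Complex.one_re, Complex.one_im]
  ring

/-- The mass in `ℂ` of the density `v ↦ G (l + |v|²)`: the value at squared distance `l` from the
centre of the complex one-dimensional marginal of a spherical density on `ℂ²`, where `G` is the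
density as a function of the squared distance from the centre. -/
def planarMarginal (G : ℝ → ENNReal) (l : ℝ) : ENNReal :=
  ENNReal.ofReal π * ∫⁻ y in Ioi l, G y

theorem planarMarginal_antitone (G : ℝ → ENNReal) : Antitone (planarMarginal G) := by
  intro l m hlm
  unfold planarMarginal
  gcongr

theorem lintegral_Ioi_comp_affine {f : ℝ → ENNReal} {N : ℝ} (hN : 0 < N) (k : ℝ) :
    ∫⁻ y in Ioi k, f y = ENNReal.ofReal N * ∫⁻ t in Ioi (0 : ℝ), f (N * t + k) := by
  have himg : (fun t : ℝ => N * t + k) '' Ioi 0 = Ioi k := by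
    ext y
    constructor
    · rintro ⟨t, ht, rfl⟩
      have := mul_pos hN (mem_Ioi.1 ht)
      simp only [mem_Ioi]
      linarith
    · intro hy
      refine ⟨(y - k) / N, div_pos (sub_pos.2 hy) hN, ?_⟩
      field_simp
      ring
  rw [← himg, lintegral_image_eq_lintegral_abs_deriv_mul (f' := fun _ => N) measurableSet_Ioi,
    abs_of_pos hN, lintegral_const_mul' _ _ ENNReal.ofReal_ne_top]
  · intro t _
    simpa using (((hasDerivAt_id t).const_mul N).add_const k).hasDerivWithinAt
  · intro x _ y _ hxy
    simpa [hN.ne'] using hxy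

theorem lintegral_comp_add_norm_sq {G : ℝ → ENNReal} (hG : Measurable G) (l : ℝ) (b : ℂ) :
    ∫⁻ v : ℂ, G (l + ‖v - b‖ ^ 2) = planarMarginal G l := by
  rw [lintegral_sub_right_eq_self (fun v : ℂ => G (l + ‖v‖ ^ 2)),
    lintegral_comp_norm_sq (f := fun t => G (l + t)) (by fun_prop), planarMarginal,
    lintegral_Ioi_comp_affine one_pos l]
  simp [add_comm]

/-- Tonelli's theorem for the iterated tail integral. -/
theorem lintegral_lintegral_Ioi {G : ℝ → ENNReal} (hG : Measurable G) (k : ℝ) :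
    ∫⁻ l in Ioi k, ∫⁻ y in Ioi l, G y = ∫⁻ y in Ioi k, ENNReal.ofReal (y - k) * G y := by
  have h1 : ∀ l : ℝ, ∫⁻ y in Ioi l, G y = ∫⁻ y, (Ioi l).indicator G y := fun l =>
    (lintegral_indicator measurableSet_Ioi G).symm
  have hm : Measurable (fun p : ℝ × ℝ => (Ioi p.1).indicator G p.2) := by
    have : (fun p : ℝ × ℝ => (Ioi p.1).indicator G p.2)
        = {p : ℝ × ℝ | p.1 < p.2}.indicator fun p => G p.2 := by
      funext p
      simp [indicator]
    rw [this]
    exact (hG.comp measurable_snd).indicator (measurableSet_lt measurable_fst measurable_snd)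
  simp only [h1]
  rw [lintegral_lintegral_swap hm.aemeasurable, ← lintegral_indicator measurableSet_Ioi]
  refine lintegral_congr fun y => ?_
  have h2 : ∀ l : ℝ, (Ioi l).indicator G y = (Iio y).indicator (fun _ => G y) l := by
    intro l
    simp [indicator]
  simp only [h2]
  rw [lintegral_indicator measurableSet_Iio, lintegral_const,
    Measure.restrict_restrict measurableSet_Iio, Measure.restrict_apply_univ, Iio_inter_Ioi,
    Real.volume_Ioo, mul_comm]
  by_cases hy : k < y
  · simp [indicator, hy]
  · simp [indicator, hy, ENNReal.ofReal_of_nonpos (sub_nonpos.2 (not_lt.1 hy))]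

/-- The mixed term of `|w₀ + v|²` integrates to zero against a radial weight. -/
theorem lintegral_norm_add_sq_mul {F : ℝ → ENNReal} (hF : Measurable F) (w : ℂ) :
    ∫⁻ v : ℂ, ENNReal.ofReal (‖w + v‖ ^ 2) * F (‖v‖ ^ 2)
      = ∫⁻ v : ℂ, ENNReal.ofReal (‖w‖ ^ 2 + ‖v‖ ^ 2) * F (‖v‖ ^ 2) := by
  -- average the integral with its image under `v ↦ -v` and use the parallelogram law
  have hneg : ∫⁻ v : ℂ, ENNReal.ofReal (‖w + v‖ ^ 2) * F (‖v‖ ^ 2)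
      = ∫⁻ v : ℂ, ENNReal.ofReal (‖w - v‖ ^ 2) * F (‖v‖ ^ 2) := by
    rw [← lintegral_neg_eq_self (fun v : ℂ => ENNReal.ofReal (‖w + v‖ ^ 2) * F (‖v‖ ^ 2))]
    simp only [norm_neg, ← sub_eq_add_neg]
  have h2 : 2 * ∫⁻ v : ℂ, ENNReal.ofReal (‖w + v‖ ^ 2) * F (‖v‖ ^ 2)
      = 2 * ∫⁻ v : ℂ, ENNReal.ofReal (‖w‖ ^ 2 + ‖v‖ ^ 2) * F (‖v‖ ^ 2) := by
    rw [two_mul]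
    nth_rewrite 2 [hneg]
    rw [← lintegral_add_left (by fun_prop), ← lintegral_const_mul _ (by fun_prop)]
    refine lintegral_congr fun v => ?_
    rw [← add_mul, ← ENNReal.ofReal_add (by positivity) (by positivity), ← mul_assoc,
      ← ENNReal.ofReal_ofNat 2, ← ENNReal.ofReal_mul (by norm_num)]
    have hp := parallelogram_law_with_norm ℝ w v
    congr 2
  exact (ENNReal.mul_right_inj two_ne_zero ENNReal.ofNat_ne_top).1 h2

/-- Completing the square along the complex line spanned by `(1, z)`. -/
theorem norm_sub_sq_add_norm_mul_sub_sq (c ξ z v : ℂ) :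
    ‖c * (1 + (starRingEnd ℂ) z * ξ) / ((1 + ‖z‖ ^ 2 : ℝ) : ℂ) + v - c‖ ^ 2
      + ‖(c * (1 + (starRingEnd ℂ) z * ξ) / ((1 + ‖z‖ ^ 2 : ℝ) : ℂ) + v) * z - c * ξ‖ ^ 2
      = (1 + ‖z‖ ^ 2) * ‖v‖ ^ 2 + ‖c‖ ^ 2 * lineDist ξ z := by
  obtain ⟨w, hw⟩ : ∃ w, w = c * (1 + (starRingEnd ℂ) z * ξ) / ((1 + ‖z‖ ^ 2 : ℝ) : ℂ) := ⟨_, rfl⟩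
  rw [← hw]
  have hN : 0 < 1 + ‖z‖ ^ 2 := by positivity
  rw [eq_div_iff (by exact_mod_cast hN.ne')] at hw
  have hre := congrArg Complex.re hw
  have him := congrArg Complex.im hw
  unfold lineDist
  rw [mul_div_assoc', ← sub_eq_iff_eq_add', eq_div_iff hN.ne']
  simp only [Complex.sq_norm, Complex.normSq_apply, Complex.sub_re, Complex.sub_im, Complex.add_re,
    Complex.add_im, Complex.mul_re, Complex.mul_im, Complex.conj_re, Complex.conj_im,
    Complex.one_re, Complex.one_im, Complex.ofReal_re, Complex.ofReal_im] at hre him ⊢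
  -- the two sides differ by `|N w - A|² + 2 N ⟨v, N w - A⟩`, where `A = c (1 + conj z ξ) = N w`
  linear_combination
    (w.re * (1 + (z.re * z.re + z.im * z.im))
      - (c.re * (1 + (z.re * ξ.re + z.im * ξ.im)) - c.im * (z.re * ξ.im - z.im * ξ.re))
      + 2 * (1 + (z.re * z.re + z.im * z.im)) * v.re) * hre
    + (w.im * (1 + (z.re * z.re + z.im * z.im))
      - (c.re * (z.re * ξ.im - z.im * ξ.re) + c.im * (1 + (z.re * ξ.re + z.im * ξ.im)))
      + 2 * (1 + (z.re * z.re + z.im * z.im)) * v.im) * him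

/-- The integral of `|w|² G` over the complex line spanned by `(1, z)`, where `G` is a spherical
density centred at `(c, c ξ)`. -/
theorem lintegral_line {G : ℝ → ENNReal} (hG : Measurable G) (c ξ z : ℂ) :
    ∫⁻ w : ℂ, ENNReal.ofReal (‖w‖ ^ 2) * G (‖w - c‖ ^ 2 + ‖w * z - c * ξ‖ ^ 2)
      = ENNReal.ofReal (((1 + ‖z‖ ^ 2) ^ 2)⁻¹) *
        ((∫⁻ l in Ioi (‖c‖ ^ 2 * lineDist ξ z), planarMarginal G l)
          + ENNReal.ofReal (‖c‖ ^ 2 * lineProj ξ z)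
            * planarMarginal G (‖c‖ ^ 2 * lineDist ξ z)) := by
  have hN : 0 < 1 + ‖z‖ ^ 2 := by positivity
  set w₀ : ℂ := c * (1 + (starRingEnd ℂ) z * ξ) / ((1 + ‖z‖ ^ 2 : ℝ) : ℂ) with hw
  set k : ℝ := ‖c‖ ^ 2 * lineDist ξ z with hk
  have hw₀ : ‖w₀‖ ^ 2 = ‖c‖ ^ 2 * lineProj ξ z / (1 + ‖z‖ ^ 2) := by
    rw [hw, norm_div, norm_mul, Complex.norm_real, Real.norm_of_nonneg hN.le, lineProj]
    field_simp
  rw [← lintegral_add_left_eq_self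
    (fun w : ℂ => ENNReal.ofReal (‖w‖ ^ 2) * G (‖w - c‖ ^ 2 + ‖w * z - c * ξ‖ ^ 2)) w₀]
  simp only [hw, norm_sub_sq_add_norm_mul_sub_sq]
  rw [← hw, ← hk]
  rw [lintegral_norm_add_sq_mul (F := fun t => G ((1 + ‖z‖ ^ 2) * t + k)) (by fun_prop),
    lintegral_comp_norm_sq (f := fun t => ENNReal.ofReal (‖w₀‖ ^ 2 + t) * G ((1 + ‖z‖ ^ 2) * t + k))
      (by fun_prop)]
  unfold planarMarginal
  rw [lintegral_const_mul' _ _ ENNReal.ofReal_ne_top, lintegral_lintegral_Ioi hG,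
    mul_left_comm _ (ENNReal.ofReal π), ← mul_add, mul_left_comm _ (ENNReal.ofReal π)]
  congr 1
  rw [← lintegral_const_mul _ hG, ← lintegral_add_left (by fun_prop),
    ← lintegral_const_mul _ (by fun_prop), lintegral_Ioi_comp_affine hN k,
    ← lintegral_const_mul _ (by fun_prop)]
  refine setLIntegral_congr_fun measurableSet_Ioi fun t ht => ?_
  have ht' : (0 : ℝ) < t := ht
  have hu := lineProj_nonneg ξ z
  simp only [add_sub_cancel_right]
  rw [← add_mul, ← ENNReal.ofReal_add (by positivity) (by positivity), ← mul_assoc, ← mul_assoc,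
    ← ENNReal.ofReal_mul (by positivity), ← ENNReal.ofReal_mul (by positivity), hw₀]
  congr 2
  field_simp
  ring

theorem lintegral_comp_complex_mul {w : ℂ} (hw : w ≠ 0) {f : ℂ → ENNReal} (hf : Measurable f) :
    ∫⁻ x : ℂ, f x = ENNReal.ofReal (‖w‖ ^ 2) * ∫⁻ z : ℂ, f (w * z) := by
  have hdet : LinearMap.det (LinearMap.mul ℝ ℂ w) = ‖w‖ ^ 2 := by
    rw [Complex.sq_norm, ← Algebra.norm_complex_apply]
    exact (Algebra.norm_apply ℝ w).symm
  have hpos : 0 < ‖w‖ ^ 2 := by positivity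
  have hmap := Measure.map_linearMap_addHaar_eq_smul_addHaar (volume : Measure ℂ)
    (f := LinearMap.mul ℝ ℂ w) (by rw [hdet]; exact hpos.ne')
  have h := lintegral_map (μ := volume) hf (g := LinearMap.mul ℝ ℂ w) (by
    exact measurable_const_mul w)
  rw [hmap, hdet, lintegral_smul_measure, abs_of_pos (by positivity), smul_eq_mul] at h
  simp only [LinearMap.mul_apply'] at h
  rw [← h, ← mul_assoc, ← ENNReal.ofReal_mul hpos.le, mul_inv_cancel₀ hpos.ne',
    ENNReal.ofReal_one, one_mul]

/-- The law of the quotient `x₂ / x₁` under a measure on `ℂ × ℂ` with a density. -/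
theorem map_div_withDensity {F : ℂ × ℂ → ENNReal} (hF : Measurable F) :
    ((volume : Measure (ℂ × ℂ)).withDensity F).map (fun x => x.2 / x.1)
      = volume.withDensity fun z => ∫⁻ w : ℂ, ENNReal.ofReal (‖w‖ ^ 2) * F (w, w * z) := by
  have hd : Measurable (fun x : ℂ × ℂ => x.2 / x.1) := measurable_snd.div measurable_fst
  ext s hs
  have hm : Measurable (((fun x : ℂ × ℂ => x.2 / x.1) ⁻¹' s).indicator F) := hF.indicator (hd hs)
  rw [Measure.map_apply hd hs, withDensity_apply _ (hd hs), withDensity_apply _ hs,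
    ← lintegral_indicator (hd hs), Measure.volume_eq_prod, lintegral_prod _ hm.aemeasurable,
    ← lintegral_indicator hs]
  have hs' : ∀ z : ℂ, s.indicator (fun z => ∫⁻ w : ℂ, ENNReal.ofReal (‖w‖ ^ 2) * F (w, w * z)) z
      = ∫⁻ w : ℂ, s.indicator (fun z => ENNReal.ofReal (‖w‖ ^ 2) * F (w, w * z)) z := by
    intro z
    by_cases hz : z ∈ s <;> simp [hz]
  have hF2 : Measurable fun p : ℂ × ℂ => ENNReal.ofReal (‖p.2‖ ^ 2) * F (p.2, p.2 * p.1) := by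
    fun_prop
  simp only [hs']
  rw [lintegral_lintegral_swap (f := fun z w : ℂ =>
    s.indicator (fun z => ENNReal.ofReal (‖w‖ ^ 2) * F (w, w * z)) z)]
  · have h0 : ∀ᵐ w : ℂ, w ≠ 0 := by simp [ae_iff]
    refine lintegral_congr_ae ?_
    filter_upwards [h0] with w hw
    rw [lintegral_comp_complex_mul hw (by fun_prop), ← lintegral_const_mul _ (by fun_prop)]
    refine lintegral_congr fun z => ?_
    by_cases hz : z ∈ s <;> simp [hw, hz]
  · refine Measurable.aemeasurable ?_
    have : (Function.uncurry fun (z w : ℂ) =>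
        s.indicator (fun z => ENNReal.ofReal (‖w‖ ^ 2) * F (w, w * z)) z)
        = (Prod.fst ⁻¹' s).indicator
          fun p : ℂ × ℂ => ENNReal.ofReal (‖p.2‖ ^ 2) * F (p.2, p.2 * p.1) := by
      funext p
      rfl
    rw [this]
    exact hF2.indicator (measurable_fst hs)

/-! ### The complex one-dimensional stable density -/

theorem integrable_norm_pow_mul_exp_neg_rpow (n : ℕ) {α b : ℝ} (hα : 0 < α) (hb : 0 < b) :
    Integrable fun t : ℂ => ‖t‖ ^ n * Real.exp (-(b * ‖t‖) ^ α) := by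
  rw [integrable_fun_norm_addHaar (volume : Measure ℂ)
    (f := fun r => r ^ n * Real.exp (-(b * r) ^ α)), Complex.finrank_real_complex]
  have h := integrableOn_rpow_mul_exp_neg_mul_rpow (p := α) (s := n + 1) (b := b ^ α)
    (by linarith [n.cast_nonneg (α := ℝ)]) hα (by positivity)
  refine h.congr_fun (fun r hr => ?_) measurableSet_Ioi
  have hr' : (0 : ℝ) < r := hr
  simp only [smul_eq_mul]
  rw [Real.mul_rpow hb.le hr'.le, neg_mul]
  norm_cast
  ring

theorem integral_exp_neg_mul_norm_rpow {α : ℝ} (hα : 0 < α) :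
    ∫ t : ℂ, Real.exp (-(π * ‖t‖) ^ α) = Real.Gamma (1 + 2 / α) / π := by
  rw [integral_fun_norm_addHaar (volume : Measure ℂ) (fun r => Real.exp (-(π * r) ^ α)),
    Complex.finrank_real_complex]
  have h : ∫ r in Ioi (0 : ℝ), r ^ (2 - 1) • Real.exp (-(π * r) ^ α)
      = ∫ r in Ioi (0 : ℝ), r ^ (1 : ℝ) * Real.exp (-(π ^ α) * r ^ α) := by
    refine setIntegral_congr_fun measurableSet_Ioi fun r hr => ?_
    have hr' : (0 : ℝ) < r := hr
    simp only [smul_eq_mul]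
    rw [Real.mul_rpow Real.pi_pos.le hr'.le, neg_mul]
    simp
  rw [h, integral_rpow_mul_exp_neg_mul_rpow hα (by norm_num) (by positivity), Measure.real,
    Complex.volume_ball, ← Real.rpow_mul Real.pi_pos.le, add_comm 1 (2 / α),
    Real.Gamma_add_one (by positivity)]
  have h2 : α * (-(1 + 1) / α) = -2 := by field_simp; norm_num
  rw [h2, Real.rpow_neg Real.pi_pos.le]
  norm_num
  field_simp

/-- The density on `ℂ`, as a function of the squared distance `k` from the centre, of the isotropic
`α`-stable law with characteristic function `t ↦ exp (-(|t| / 2) ^ α)`, written as an inverse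
Fourier integral. It is a total function of `k`, with `√k = 0` for `k < 0`. -/
def stablePlanarDensity (α k : ℝ) : ℝ :=
  ∫ t : ℂ, Real.exp (-(π * ‖t‖) ^ α) * Real.cos (2 * π * (√k * t.re))

theorem integrable_exp_neg_norm_rpow {α b : ℝ} (hα : 0 < α) (hb : 0 < b) :
    Integrable fun t : ℂ => Real.exp (-(b * ‖t‖) ^ α) := by
  simpa using integrable_norm_pow_mul_exp_neg_rpow 0 hα hb

theorem integrable_stablePlanarDensity_integrand {α : ℝ} (hα : 0 < α) (k : ℝ) :
    Integrable fun t : ℂ => Real.exp (-(π * ‖t‖) ^ α) * Real.cos (2 * π * (√k * t.re)) := by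
  refine (integrable_exp_neg_norm_rpow hα Real.pi_pos).mono'
    (by fun_prop) (Eventually.of_forall fun t => ?_)
  rw [norm_mul, Real.norm_of_nonneg (Real.exp_pos _).le]
  exact mul_le_of_le_one_right (Real.exp_pos _).le (Real.abs_cos_le_one _)

theorem stablePlanarDensity_zero {α : ℝ} (hα : 0 < α) :
    stablePlanarDensity α 0 = Real.Gamma (1 + 2 / α) / π := by
  simp [stablePlanarDensity, integral_exp_neg_mul_norm_rpow hα]

theorem continuous_stablePlanarDensity {α : ℝ} (hα : 0 < α) :
    Continuous (stablePlanarDensity α) := by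
  refine continuous_of_dominated (bound := fun t : ℂ => Real.exp (-(π * ‖t‖) ^ α))
    (fun k => (integrable_stablePlanarDensity_integrand hα k).aestronglyMeasurable)
    (fun k => Eventually.of_forall fun t => ?_) (integrable_exp_neg_norm_rpow hα Real.pi_pos)
    (Eventually.of_forall fun t => by fun_prop)
  rw [norm_mul, Real.norm_of_nonneg (Real.exp_pos _).le]
  exact mul_le_of_le_one_right (Real.exp_pos _).le (Real.abs_cos_le_one _)

/-- Lipschitz continuity at `0`, from `1 - cos x ≤ x² / 2` and the finite second moment of the
stable characteristic function. -/
theorem exists_abs_stablePlanarDensity_sub_le {α : ℝ} (hα : 0 < α) :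
    ∃ L, 0 ≤ L ∧ ∀ k, 0 ≤ k →
      |stablePlanarDensity α k - Real.Gamma (1 + 2 / α) / π| ≤ L * k := by
  have hI := (integrable_norm_pow_mul_exp_neg_rpow 2 hα Real.pi_pos).const_mul (2 * π ^ 2)
  refine ⟨∫ t : ℂ, 2 * π ^ 2 * (‖t‖ ^ 2 * Real.exp (-(π * ‖t‖) ^ α)),
    integral_nonneg fun t => by positivity, fun k hk => ?_⟩
  rw [← stablePlanarDensity_zero hα, stablePlanarDensity, stablePlanarDensity,
    ← integral_sub (integrable_stablePlanarDensity_integrand hα k)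
      (integrable_stablePlanarDensity_integrand hα 0), ← Real.norm_eq_abs, ← integral_mul_const]
  refine norm_integral_le_of_norm_le (hI.mul_const k) (Eventually.of_forall fun t => ?_)
  have hcos : |Real.cos (2 * π * (√k * t.re)) - 1| ≤ 2 * π ^ 2 * (‖t‖ ^ 2 * k) := by
    have h1 := Real.one_sub_sq_div_two_le_cos (x := 2 * π * (√k * t.re))
    have h2 := Real.cos_le_one (2 * π * (√k * t.re))
    have h3 : t.re ^ 2 ≤ ‖t‖ ^ 2 := sq_le_sq.2 (by simpa using Complex.abs_re_le_norm t)
    have h4 : (2 * π * (√k * t.re)) ^ 2 / 2 = 2 * π ^ 2 * (t.re ^ 2 * k) := by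
      rw [mul_pow, mul_pow, mul_pow, Real.sq_sqrt hk]
      ring
    have h5 : 2 * π ^ 2 * (t.re ^ 2 * k) ≤ 2 * π ^ 2 * (‖t‖ ^ 2 * k) := by gcongr
    rw [abs_le]
    constructor <;> linarith [show 0 ≤ 2 * π ^ 2 * (t.re ^ 2 * k) by positivity]
  simp only [Real.sqrt_zero, zero_mul, mul_zero, Real.cos_zero]
  rw [← mul_sub, norm_mul, Real.norm_of_nonneg (Real.exp_pos _).le, Real.norm_eq_abs]
  calc _ ≤ Real.exp (-(π * ‖t‖) ^ α) * (2 * π ^ 2 * (‖t‖ ^ 2 * k)) := by gcongr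
    _ = _ := by ring

/-! ### Fourier inversion for the planar marginal -/

theorem measurable_planarMarginal (G : ℝ → ENNReal) : Measurable (planarMarginal G) :=
  (planarMarginal_antitone G).measurable

theorem map_fst_withDensity {G : ℝ → ENNReal} (hG : Measurable G) (c b : ℂ) :
    ((volume : Measure (ℂ × ℂ)).withDensity
        fun x => G (‖x.1 - c‖ ^ 2 + ‖x.2 - b‖ ^ 2)).map Prod.fst
      = volume.withDensity fun x => planarMarginal G (‖x - c‖ ^ 2) := by
  have hF : Measurable fun x : ℂ × ℂ => G (‖x.1 - c‖ ^ 2 + ‖x.2 - b‖ ^ 2) := by fun_prop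
  ext s hs
  rw [Measure.map_apply measurable_fst hs, withDensity_apply _ (measurable_fst hs),
    withDensity_apply _ hs, ← prod_univ, Measure.volume_eq_prod,
    setLIntegral_prod _ hF.aemeasurable]
  simp only [Measure.restrict_univ, lintegral_comp_add_norm_sq hG]

theorem lintegral_planarMarginal {G : ℝ → ENNReal} {c : ℂ}
    (hP : IsProbabilityMeasure
      ((volume : Measure ℂ).withDensity fun x => planarMarginal G (‖x - c‖ ^ 2))) :
    ∫⁻ l in Ioi (0 : ℝ), planarMarginal G l = ENNReal.ofReal (1 / π) := by
  have h := hP.measure_univ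
  rw [withDensity_apply _ MeasurableSet.univ, Measure.restrict_univ,
    lintegral_sub_right_eq_self (fun x : ℂ => planarMarginal G (‖x‖ ^ 2)),
    lintegral_comp_norm_sq (measurable_planarMarginal G)] at h
  rw [one_div, ENNReal.ofReal_inv_of_pos Real.pi_pos]
  exact ENNReal.eq_inv_of_mul_eq_one_left (by rw [mul_comm]; exact h)

theorem planarMarginal_lt_top {G : ℝ → ENNReal}
    (hG : ∫⁻ l in Ioi (0 : ℝ), planarMarginal G l ≠ ⊤) {l : ℝ} (hl : 0 < l) :
    planarMarginal G l < ⊤ := by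
  by_contra h
  have hl' : planarMarginal G l = ⊤ := by simpa using h
  refine hG (top_le_iff.1 ?_)
  calc (⊤ : ENNReal) = ∫⁻ _ in Ioc (0 : ℝ) l, (⊤ : ENNReal) := by
        simp [hl]
    _ ≤ ∫⁻ m in Ioc (0 : ℝ) l, planarMarginal G m :=
        setLIntegral_mono' measurableSet_Ioc fun m hm => by
          rw [← hl']
          exact planarMarginal_antitone G hm.2
    _ ≤ _ := lintegral_mono_set Ioc_subset_Ioi_self

theorem continuousOn_planarMarginal {G : ℝ → ENNReal} (hG : Measurable G)
    (hfin : ∫⁻ l in Ioi (0 : ℝ), planarMarginal G l ≠ ⊤) :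
    ContinuousOn (fun l => (planarMarginal G l).toReal) (Ioi 0) := by
  have hT : ∀ l : ℝ, 0 < l → ∫⁻ y in Ioi l, G y ≠ ⊤ := by
    intro l hl h
    have := planarMarginal_lt_top hfin hl
    rw [planarMarginal, h, ENNReal.mul_top (by simp [Real.pi_pos])] at this
    exact lt_irrefl _ this
  intro l hl
  have hl' : (0 : ℝ) < l := hl
  have ha : 0 < l / 2 := by positivity
  have hint : Integrable ((Ioi (l / 2)).indicator fun y => (G y).toReal) :=
    (integrable_indicator_iff measurableSet_Ioi).2
      (integrable_toReal_of_lintegral_ne_top hG.aemeasurable (hT _ ha))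
  have hcont : Continuous fun m : ℝ => π * (∫ y in Ioi (l / 2), (G y).toReal)
      - π * ∫ y in (l / 2)..m, (Ioi (l / 2)).indicator (fun y => (G y).toReal) y :=
    continuous_const.sub (continuous_const.mul (hint.continuous_primitive _))
  refine (hcont.continuousAt.congr ?_).continuousWithinAt
  filter_upwards [Ioi_mem_nhds (show l / 2 < l by linarith)] with m hm
  have hm' : l / 2 < m := hm
  have hval : (planarMarginal G m).toReal = π * ∫ y in Ioi m, (G y).toReal := by
    rw [planarMarginal, ENNReal.toReal_mul, ENNReal.toReal_ofReal Real.pi_pos.le,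
      integral_toReal hG.aemeasurable
        (ae_lt_top hG (hT m (ha.trans hm')))]
  rw [hval, ← mul_sub]
  congr 1
  rw [intervalIntegral.integral_of_le hm'.le, setIntegral_indicator measurableSet_Ioi,
    inter_eq_left.2 Ioc_subset_Ioi_self, sub_eq_iff_eq_add', ← Ioc_union_Ioi_eq_Ioi hm'.le]
  have hio := integrable_toReal_of_lintegral_ne_top hG.aemeasurable (hT _ ha)
  exact setIntegral_union (Ioc_disjoint_Ioi le_rfl) measurableSet_Ioi
    (IntegrableOn.mono_set hio Ioc_subset_Ioi_self)
    (IntegrableOn.mono_set hio (Ioi_subset_Ioi hm'.le))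

open scoped FourierTransform in
/-- A planar law with density `T (|x - c|²)`, `T` a planar marginal, whose characteristic function
is the isotropic `α`-stable one, has the density given by Fourier inversion. The inversion formula
holds at every `l > 0` because `T` is continuous there. -/
theorem planarMarginal_eq_stablePlanarDensity {G : ℝ → ENNReal} (hG : Measurable G) {α σ : ℝ}
    (hα : 0 < α) (hσ : 0 < σ) {c : ℂ}
    (hfin : ∫⁻ l in Ioi (0 : ℝ), planarMarginal G l ≠ ⊤)
    (hchar : ∀ t : ℂ, charFun
      ((volume : Measure ℂ).withDensity fun x => planarMarginal G (‖x - c‖ ^ 2)) t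
        = Complex.exp (((inner ℝ t c : ℝ) : ℂ) * Complex.I - (((σ * ‖t‖ / 2) ^ α : ℝ) : ℂ)))
    {l : ℝ} (hl : 0 < l) :
    (planarMarginal G l).toReal = (σ ^ 2)⁻¹ * stablePlanarDensity α (l / σ ^ 2) := by
  have hTm := measurable_planarMarginal G
  set f : ℂ → ℂ := fun x => ((planarMarginal G (‖x‖ ^ 2)).toReal : ℂ) with hf
  have hfi : Integrable f := by
    refine (integrable_toReal_of_lintegral_ne_top (by fun_prop) ?_).ofReal
    rw [lintegral_comp_norm_sq hTm]
    exact ENNReal.mul_ne_top ENNReal.ofReal_ne_top hfin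
  have hae : ∀ᵐ x : ℂ, planarMarginal G (‖x - c‖ ^ 2) < ⊤ := by
    have : ∀ᵐ x : ℂ, x ≠ c := by simp [ae_iff]
    filter_upwards [this] with x hx
    exact planarMarginal_lt_top hfin (by have := norm_pos_iff.2 (sub_ne_zero.2 hx); positivity)
  have hFourier : 𝓕 f = fun t => ((Real.exp (-(π * σ * ‖t‖) ^ α) : ℝ) : ℂ) := by
    funext t
    -- the Fourier transform at `t` is the characteristic function at `-2 π t`
    have h := hchar ((-(2 * π) : ℝ) • t)
    rw [charFun_apply, integral_withDensity_eq_integral_toReal_smul (by fun_prop) hae,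
      ← integral_add_right_eq_self _ c] at h
    simp only [add_sub_cancel_right] at h
    have hnorm : σ * ‖(-(2 * π) : ℝ) • t‖ / 2 = π * σ * ‖t‖ := by
      rw [norm_smul, norm_neg, Real.norm_of_nonneg (by positivity)]
      ring
    rw [hnorm, sub_eq_add_neg, Complex.exp_add, real_inner_comm] at h
    have h2 : ∀ x : ℂ, (planarMarginal G (‖x‖ ^ 2)).toReal
        • Complex.exp (((inner ℝ (x + c) ((-(2 * π) : ℝ) • t) : ℝ) : ℂ) * Complex.I)
        = Complex.exp (((inner ℝ c ((-(2 * π) : ℝ) • t) : ℝ) : ℂ) * Complex.I)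
          * (Complex.exp (((-2 * π * inner ℝ x t : ℝ) : ℂ) * Complex.I) • f x) := by
      intro x
      have hi : inner ℝ x ((-(2 * π) : ℝ) • t) = -2 * π * inner ℝ x t := by
        rw [real_inner_smul_right]
        ring
      rw [inner_add_left, Complex.ofReal_add, add_mul, Complex.exp_add, hf, hi]
      simp only [Complex.real_smul, smul_eq_mul]
      ring
    simp only [h2] at h
    rw [integral_const_mul] at h
    rw [Real.fourier_eq', mul_left_cancel₀ (Complex.exp_ne_zero _) h]
    push_cast
    rfl
  have hgi : Integrable fun t : ℂ => Real.exp (-(π * σ * ‖t‖) ^ α) :=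
    integrable_exp_neg_norm_rpow hα (by positivity)
  have hx : ‖((√l : ℝ) : ℂ)‖ ^ 2 = l := by
    rw [Complex.norm_real, Real.norm_of_nonneg (Real.sqrt_nonneg l), Real.sq_sqrt hl.le]
  have hcont : ContinuousAt f ((√l : ℝ) : ℂ) := by
    have h1 := (continuousOn_planarMarginal hG hfin).continuousAt (Ioi_mem_nhds hl)
    rw [← hx] at h1
    have h2 : ContinuousAt (fun x : ℂ => ‖x‖ ^ 2) ((√l : ℝ) : ℂ) := by fun_prop
    exact Complex.continuous_ofReal.continuousAt.comp
      (ContinuousAt.comp (f := fun x : ℂ => ‖x‖ ^ 2) h1 h2)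
  have hinv := hfi.fourierInv_fourier_eq (by rw [hFourier]; exact hgi.ofReal) hcont
  rw [hFourier, Real.fourierInv_eq'] at hinv
  have hval : (planarMarginal G l).toReal
      = ∫ t : ℂ, Real.exp (-(π * σ * ‖t‖) ^ α) * Real.cos (2 * π * (√l * t.re)) := by
    have h1 : (f ((√l : ℝ) : ℂ)).re = (planarMarginal G l).toReal := by
      simp only [hf, hx, Complex.ofReal_re]
    rw [← h1, ← hinv, ← RCLike.re_eq_complex_re, ← integral_re]
    · refine integral_congr_ae (Eventually.of_forall fun t => ?_)
      simp only [RCLike.re_eq_complex_re, smul_eq_mul]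
      rw [Complex.re_mul_ofReal, Complex.exp_ofReal_mul_I_re, mul_comm]
      simp [Complex.inner]
    · refine hgi.mono' (by fun_prop) (Eventually.of_forall fun t => ?_)
      rw [norm_smul, Complex.norm_exp_ofReal_mul_I, one_mul, Complex.norm_real,
        Real.norm_of_nonneg (Real.exp_pos _).le]
  have hscale : ∫ t : ℂ, Real.exp (-(π * σ * ‖t‖) ^ α) * Real.cos (2 * π * (√l * t.re))
      = (σ ^ 2)⁻¹ * stablePlanarDensity α (l / σ ^ 2) := by
    have h := Measure.integral_comp_smul (volume : Measure ℂ)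
      (fun t => Real.exp (-(π * ‖t‖) ^ α) * Real.cos (2 * π * (√(l / σ ^ 2) * t.re))) σ
    rw [Complex.finrank_real_complex, abs_of_pos (by positivity), smul_eq_mul] at h
    rw [stablePlanarDensity, ← h]
    refine integral_congr_ae (Eventually.of_forall fun t => ?_)
    simp only [norm_smul, Real.norm_of_nonneg hσ.le, Complex.smul_re, smul_eq_mul,
      Real.sqrt_div hl.le, Real.sqrt_sq hσ.le]
    have hs : √l / σ * (σ * t.re) = √l * t.re := by field_simp
    rw [hs, mul_assoc π σ]
  rw [← hscale, ← hval]

/-! ### The pole density -/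

/-- The density of the quotient of two complex data `c`, `c ξ` with spherical `α`-stable noise, at
signal-to-noise ratio `ρ`. The truncation at `0` makes it nonnegative for all parameters without a
construction of the stable law; the truncated expression is nonnegative anyway where such a law
exists. -/
def poleDensity (α ρ : ℝ) (ξ z : ℂ) : ℝ :=
  max 0 (((1 + ‖z‖ ^ 2) ^ 2)⁻¹ *
    (1 / π - (∫ l in (0 : ℝ)..(ρ * lineDist ξ z), stablePlanarDensity α l)
      + ρ * lineProj ξ z * stablePlanarDensity α (ρ * lineDist ξ z)))

theorem poleDensity_nonneg (α ρ : ℝ) (ξ z : ℂ) : 0 ≤ poleDensity α ρ ξ z := le_max_left _ _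

theorem continuous_lineDist (ξ : ℂ) : Continuous (lineDist ξ) := by
  unfold lineDist
  exact Continuous.div (by fun_prop) (by fun_prop) fun z => by positivity

theorem continuous_lineProj (ξ : ℂ) : Continuous (lineProj ξ) := by
  unfold lineProj
  exact Continuous.div (by fun_prop) (by fun_prop) fun z => by positivity

theorem continuous_poleDensity {α : ℝ} (hα : 0 < α) (ρ : ℝ) (ξ : ℂ) :
    Continuous (poleDensity α ρ ξ) := by
  have hq := continuous_stablePlanarDensity hα
  have hD := continuous_lineDist ξ
  have hu := continuous_lineProj ξ
  have hI : Continuous fun x : ℝ => ∫ l in (0 : ℝ)..x, stablePlanarDensity α l :=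
    intervalIntegral.continuous_primitive (fun a b => hq.intervalIntegrable a b) 0
  have hN : Continuous fun z : ℂ => ((1 + ‖z‖ ^ 2) ^ 2)⁻¹ :=
    Continuous.inv₀ (by fun_prop) fun z => by positivity
  unfold poleDensity
  refine continuous_const.max (hN.mul ((continuous_const.sub ?_).add ?_))
  · exact hI.comp (continuous_const.mul hD)
  · exact (continuous_const.mul hu).mul (hq.comp (continuous_const.mul hD))

section Quotient

variable {T : ℝ → ENNReal} {q : ℝ → ℝ}

theorem lintegral_Ioi_eq_ofReal_sub {m : ℝ} (hq : Continuous q)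
    (hT : ∫⁻ l in Ioi (0 : ℝ), T l = ENNReal.ofReal m)
    (hTq : ∀ l, 0 < l → T l = ENNReal.ofReal (q l)) (hq0 : ∀ l, 0 < l → 0 ≤ q l)
    (hm : 0 ≤ m) {k : ℝ} (hk : 0 ≤ k) :
    0 ≤ m - ∫ l in (0 : ℝ)..k, q l ∧
      ∫⁻ l in Ioi k, T l = ENNReal.ofReal (m - ∫ l in (0 : ℝ)..k, q l) := by
  have hI : ∫⁻ l in Ioc 0 k, T l = ENNReal.ofReal (∫ l in (0 : ℝ)..k, q l) := by
    rw [intervalIntegral.integral_of_le hk, ofReal_integral_eq_lintegral_ofReal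
      (hq.integrableOn_Ioc)
      ((ae_restrict_iff' measurableSet_Ioc).2 (Eventually.of_forall fun l hl => hq0 l hl.1))]
    exact setLIntegral_congr_fun measurableSet_Ioc fun l hl => hTq l hl.1
  have hI0 : 0 ≤ ∫ l in (0 : ℝ)..k, q l :=
    intervalIntegral.integral_nonneg_of_ae_restrict hk
      ((ae_restrict_iff' measurableSet_Icc).2 (by
        have : ∀ᵐ l : ℝ, l ≠ 0 := by simp [ae_iff]
        filter_upwards [this] with l hl hl'
        exact hq0 l (lt_of_le_of_ne hl'.1 hl.symm)))
  rw [← Ioc_union_Ioi_eq_Ioi hk, lintegral_union measurableSet_Ioi (Ioc_disjoint_Ioi le_rfl),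
    hI] at hT
  constructor
  · rw [sub_nonneg, ← ENNReal.ofReal_le_ofReal_iff hm, ← hT]
    exact le_self_add
  · rw [ENNReal.ofReal_sub _ hI0, ← hT, ENNReal.add_sub_cancel_left ENNReal.ofReal_ne_top]

end Quotient

/-- The law of the quotient of the two components of a spherical `α`-stable vector of `ℂ²` centred
at `(c, c ξ)`, given a density `G` of the squared distance from the centre. -/
theorem map_div_eq_withDensity_poleDensity {G : ℝ → ENNReal} (hG : Measurable G) {α σ : ℝ}
    (hα : 0 < α) (hσ : 0 < σ) {c : ℂ} (ξ : ℂ)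
    (hP : IsProbabilityMeasure
      ((volume : Measure ℂ).withDensity fun x => planarMarginal G (‖x - c‖ ^ 2)))
    (hchar : ∀ t : ℂ, charFun
      ((volume : Measure ℂ).withDensity fun x => planarMarginal G (‖x - c‖ ^ 2)) t
        = Complex.exp (((inner ℝ t c : ℝ) : ℂ) * Complex.I - (((σ * ‖t‖ / 2) ^ α : ℝ) : ℂ))) :
    ((volume : Measure (ℂ × ℂ)).withDensity
        fun x => G (‖x.1 - c‖ ^ 2 + ‖x.2 - c * ξ‖ ^ 2)).map (fun x => x.2 / x.1)
      = volume.withDensity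
        fun z => ENNReal.ofReal (poleDensity α (‖c‖ ^ 2 / σ ^ 2) ξ z) := by
  have hmass := lintegral_planarMarginal hP
  have hfin : ∫⁻ l in Ioi (0 : ℝ), planarMarginal G l ≠ ⊤ := by
    rw [hmass]
    exact ENNReal.ofReal_ne_top
  have hval := fun l (hl : 0 < l) =>
    planarMarginal_eq_stablePlanarDensity hG hα hσ hfin hchar hl
  have hq0 : ∀ l, 0 < l → 0 ≤ (σ ^ 2)⁻¹ * stablePlanarDensity α (l / σ ^ 2) := fun l hl => by
    rw [← hval l hl]
    exact ENNReal.toReal_nonneg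
  have hTq : ∀ l, 0 < l → planarMarginal G l
      = ENNReal.ofReal ((σ ^ 2)⁻¹ * stablePlanarDensity α (l / σ ^ 2)) := fun l hl => by
    rw [← hval l hl, ENNReal.ofReal_toReal (planarMarginal_lt_top hfin hl).ne]
  have hqc : Continuous fun l => (σ ^ 2)⁻¹ * stablePlanarDensity α (l / σ ^ 2) :=
    continuous_const.mul ((continuous_stablePlanarDensity hα).comp (by fun_prop))
  rw [map_div_withDensity (by fun_prop)]
  refine withDensity_congr_ae ?_
  -- for `z = ξ` the lower limit `|c|² D` vanishes, where the marginal is not controlled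
  have hne : ∀ᵐ z : ℂ, z ≠ ξ := by simp [ae_iff]
  filter_upwards [hne] with z hz
  rw [lintegral_line hG]
  have hD := lineDist_nonneg ξ z
  have hu := lineProj_nonneg ξ z
  obtain ⟨h0, h1⟩ := lintegral_Ioi_eq_ofReal_sub hqc hmass hTq hq0 (by positivity)
    (k := ‖c‖ ^ 2 * lineDist ξ z) (by positivity)
  rw [intervalIntegral.integral_const_mul, intervalIntegral.integral_comp_div _ (by positivity),
    smul_eq_mul, inv_mul_cancel_left₀ (by positivity), zero_div, mul_div_right_comm] at h0 h1
  have h2 : 0 ≤ ‖c‖ ^ 2 / σ ^ 2 * lineProj ξ z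
        * stablePlanarDensity α (‖c‖ ^ 2 / σ ^ 2 * lineDist ξ z) ∧
      ENNReal.ofReal (‖c‖ ^ 2 * lineProj ξ z) * planarMarginal G (‖c‖ ^ 2 * lineDist ξ z)
        = ENNReal.ofReal (‖c‖ ^ 2 / σ ^ 2 * lineProj ξ z
          * stablePlanarDensity α (‖c‖ ^ 2 / σ ^ 2 * lineDist ξ z)) := by
    rcases eq_or_ne c 0 with rfl | hc
    · simp
    · have hk : 0 < ‖c‖ ^ 2 * lineDist ξ z := by
        have := norm_pos_iff.2 hc
        have := norm_pos_iff.2 (sub_ne_zero.2 hz)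
        unfold lineDist
        positivity
      have h3 := hq0 _ hk
      have h4 : ‖c‖ ^ 2 / σ ^ 2 * lineProj ξ z
          * stablePlanarDensity α (‖c‖ ^ 2 / σ ^ 2 * lineDist ξ z)
          = ‖c‖ ^ 2 * lineProj ξ z
            * ((σ ^ 2)⁻¹ * stablePlanarDensity α (‖c‖ ^ 2 * lineDist ξ z / σ ^ 2)) := by
        rw [mul_div_right_comm]
        ring
      rw [hTq _ hk, h4, ← ENNReal.ofReal_mul (by positivity)]
      exact ⟨by positivity, rfl⟩
  rw [h1, h2.2, ← ENNReal.ofReal_add h0 h2.1, ← ENNReal.ofReal_mul (by positivity), poleDensity,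
    max_eq_right]
  exact mul_nonneg (by positivity) (add_nonneg h0 h2.1)

/-! ### Complex data with elliptical stable noise -/

section Elliptical

variable {ι : Type*} [Fintype ι] [DecidableEq ι]

theorem mahalanobis_smul_one {τ : ℝ} (hτ : τ ≠ 0) (s x : EuclideanSpace ℝ ι) :
    mahalanobis s (τ • (1 : Matrix ι ι ℝ)) x = √(τ⁻¹ * ‖x - s‖ ^ 2) := by
  have hinv : (τ • (1 : Matrix ι ι ℝ))⁻¹ = τ⁻¹ • (1 : Matrix ι ι ℝ) := by
    refine Matrix.inv_eq_left_inv ?_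
    rw [Matrix.smul_mul, Matrix.mul_smul, Matrix.one_mul, smul_smul, inv_mul_cancel₀ hτ, one_smul]
  rw [mahalanobis, hinv, Matrix.smul_mulVec, Matrix.one_mulVec, dotProduct_smul, smul_eq_mul,
    EuclideanSpace.norm_sq_eq]
  simp [dotProduct, ← sq]

/-- The elliptical density with scatter matrix `τ I`, as a function of the squared distance from
the location. -/
def sphericalDensity (ι : Type*) [Fintype ι] [DecidableEq ι] (τ : ℝ) (g : ℝ → ℝ) (y : ℝ) :
    ENNReal :=
  ENNReal.ofReal (Real.Gamma ((Fintype.card ι : ℝ) / 2) / (2 * π ^ ((Fintype.card ι : ℝ) / 2))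
    * (Real.sqrt (τ • (1 : Matrix ι ι ℝ)).det)⁻¹
    * (√(τ⁻¹ * y)) ^ (1 - (Fintype.card ι : ℤ)) * g (√(τ⁻¹ * y)))

theorem measurable_sphericalDensity (τ : ℝ) {g : ℝ → ℝ} (hg : Measurable g) :
    Measurable (sphericalDensity ι τ g) := by
  unfold sphericalDensity
  have h : Measurable fun y : ℝ => √(τ⁻¹ * y) := by fun_prop
  exact (((h.pow_const (1 - (Fintype.card ι : ℤ))).const_mul _).mul (hg.comp h)).ennreal_ofReal

theorem ofReal_ellipticalDensity_smul_one {τ : ℝ} (hτ : τ ≠ 0) (s : EuclideanSpace ℝ ι) (g : ℝ → ℝ)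
    (x : EuclideanSpace ℝ ι) :
    ENNReal.ofReal (ellipticalDensity s (τ • (1 : Matrix ι ι ℝ)) g x)
      = sphericalDensity ι τ g (‖x - s‖ ^ 2) := by
  rw [ellipticalDensity, mahalanobis_smul_one hτ, sphericalDensity]

end Elliptical

section Data

variable {Ω : Type*} [MeasurableSpace Ω] {μ : Measure Ω} {a : Ω → Fin 2 → ℂ} {c ξ : ℂ} {σ : ℝ}
  {g : ℝ → ℝ}

theorem map_data_eq_withDensity (ha : AEMeasurable a μ) (hσ : 0 < σ)
    (hE : IsElliptical (reIm fun k : Fin 2 => c * ξ ^ (k : ℕ))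
      ((σ ^ 2 / 2) • (1 : Matrix (Fin 2 ⊕ Fin 2) (Fin 2 ⊕ Fin 2) ℝ)) g
      (μ.map fun ω => reIm (a ω))) :
    μ.map (fun ω => (a ω 0, a ω 1)) = (volume : Measure (ℂ × ℂ)).withDensity fun x =>
      sphericalDensity (Fin 2 ⊕ Fin 2) (σ ^ 2 / 2) g (‖x.1 - c‖ ^ 2 + ‖x.2 - c * ξ‖ ^ 2) := by
  set s : Fin 2 → ℂ := fun k => c * ξ ^ (k : ℕ) with hs
  set G := sphericalDensity (Fin 2 ⊕ Fin 2) (σ ^ 2 / 2) g with hG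
  have h1 : μ.map (fun ω => reIm (a ω)) = volume.withDensity fun x => G (‖x - reIm s‖ ^ 2) := by
    rw [hE.density]
    simp only [ofReal_ellipticalDensity_smul_one (show σ ^ 2 / 2 ≠ 0 by positivity), hG]
  have he : MeasurePreserving (reImEquiv 2) := by
    rw [coe_reImEquiv]
    exact measurePreserving_reIm 2
  have h2 : μ.map a = volume.withDensity fun b => G (‖reIm b - reIm s‖ ^ 2) := by
    have h := map_withDensity_of_measurePreserving (reImEquiv 2).symm he.symm
      (f := fun b => G (‖reIm b - reIm s‖ ^ 2))
    have hx : ∀ x, reIm ((reImEquiv 2).symm x) = x := fun x => by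
      rw [← coe_reImEquiv, MeasurableEquiv.apply_symm_apply]
    simp only [hx] at h
    have hr : AEMeasurable (fun ω => reIm (a ω)) μ :=
      (measurePreserving_reIm 2).measurable.comp_aemeasurable ha
    rw [← h, ← h1, AEMeasurable.map_map_of_aemeasurable
      (reImEquiv 2).symm.measurable.aemeasurable hr]
    congr 1
  have h3 := map_withDensity_of_measurePreserving
    (MeasurableEquiv.finTwoArrow : (Fin 2 → ℂ) ≃ᵐ ℂ × ℂ) (volume_preserving_finTwoArrow ℂ)
    (f := fun x => G (‖x.1 - c‖ ^ 2 + ‖x.2 - c * ξ‖ ^ 2))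
  rw [← h3, show (fun ω => (a ω 0, a ω 1))
    = (MeasurableEquiv.finTwoArrow : (Fin 2 → ℂ) ≃ᵐ ℂ × ℂ) ∘ a from rfl,
    ← AEMeasurable.map_map_of_aemeasurable (by fun_prop) ha, h2]
  simp [norm_reIm_sub_sq, Fin.sum_univ_two, hs, MeasurableEquiv.finTwoArrow]

theorem charFun_map_data_zero {α : ℝ} (ha : AEMeasurable a μ) (hσ : 0 < σ)
    (hS : IsStable α (reIm fun k : Fin 2 => c * ξ ^ (k : ℕ))
      ((σ ^ 2 / 2) • (1 : Matrix (Fin 2 ⊕ Fin 2) (Fin 2 ⊕ Fin 2) ℝ))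
      (μ.map fun ω => reIm (a ω))) (t : ℂ) :
    charFun (μ.map fun ω => a ω 0) t
      = Complex.exp (((inner ℝ t c : ℝ) : ℂ) * Complex.I - (((σ * ‖t‖ / 2) ^ α : ℝ) : ℂ)) := by
  have hinner : ∀ b : Fin 2 → ℂ, inner ℝ (reIm b) (reIm ![t, 0]) = inner ℝ (b 0) t := by
    intro b
    simp [PiLp.inner_apply, Fintype.sum_sum_type, reIm, Complex.inner, Fin.sum_univ_two]
  have h0 : AEMeasurable (fun ω => a ω 0) μ := by fun_prop
  have h := hS (reIm ![t, 0])
  have hr : AEMeasurable (fun ω => reIm (a ω)) μ :=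
    (measurePreserving_reIm 2).measurable.comp_aemeasurable ha
  have hexp : ∀ {E : Type} [NormedAddCommGroup E] [InnerProductSpace ℝ E] (v : E),
      Continuous fun x : E => Complex.exp (((inner ℝ x v : ℝ) : ℂ) * Complex.I) := by
    intro E _ _ v
    fun_prop
  rw [charFun_apply, integral_map hr (hexp _).aestronglyMeasurable] at h
  rw [charFun_apply, integral_map h0 (hexp _).aestronglyMeasurable]
  simp only [hinner] at h
  have hquad : dotProduct (reIm ![t, 0]).ofLp
      (((σ ^ 2 / 2) • (1 : Matrix (Fin 2 ⊕ Fin 2) (Fin 2 ⊕ Fin 2) ℝ)).mulVec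
        (reIm ![t, 0]).ofLp) / 2 = (σ * ‖t‖ / 2) ^ 2 := by
    rw [Matrix.smul_mulVec, Matrix.one_mulVec, dotProduct_smul, smul_eq_mul, div_pow, mul_pow,
      Complex.sq_norm, Complex.normSq_apply]
    simp [dotProduct, reIm, Fintype.sum_sum_type, Fin.sum_univ_two]
    ring
  rw [h, hquad, real_inner_comm, hinner, real_inner_comm, ← Real.rpow_natCast,
    ← Real.rpow_mul (by positivity)]
  simp [mul_div_cancel₀]

theorem ae_padePoles_eq_and_map_div_eq {α : ℝ} [IsProbabilityMeasure μ] (ha : AEMeasurable a μ)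
    (hα : 0 < α) (hσ : 0 < σ)
    (hE : IsElliptical (reIm fun k : Fin 2 => c * ξ ^ (k : ℕ))
      ((σ ^ 2 / 2) • (1 : Matrix (Fin 2 ⊕ Fin 2) (Fin 2 ⊕ Fin 2) ℝ)) g
      (μ.map fun ω => reIm (a ω)))
    (hS : IsStable α (reIm fun k : Fin 2 => c * ξ ^ (k : ℕ))
      ((σ ^ 2 / 2) • (1 : Matrix (Fin 2 ⊕ Fin 2) (Fin 2 ⊕ Fin 2) ℝ))
      (μ.map fun ω => reIm (a ω))) :
    (∀ᵐ ω ∂μ, padePoles (p := 1) (a ω) = {a ω 1 / a ω 0}) ∧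
      μ.map (fun ω => a ω 1 / a ω 0)
        = volume.withDensity
          fun z => ENNReal.ofReal (poleDensity α (‖c‖ ^ 2 / σ ^ 2) ξ z) := by
  have hG := measurable_sphericalDensity (ι := Fin 2 ⊕ Fin 2) (σ ^ 2 / 2) hE.measurable
  have hlaw := map_data_eq_withDensity ha hσ hE
  have h0 : AEMeasurable (fun ω => a ω 0) μ := by fun_prop
  have h01 : AEMeasurable (fun ω => (a ω 0, a ω 1)) μ := by fun_prop
  have hmarg : μ.map (fun ω => a ω 0) = volume.withDensity fun x =>
      planarMarginal (sphericalDensity (Fin 2 ⊕ Fin 2) (σ ^ 2 / 2) g) (‖x - c‖ ^ 2) := by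
    rw [← map_fst_withDensity hG c (c * ξ), ← hlaw,
      AEMeasurable.map_map_of_aemeasurable (by fun_prop) h01]
    rfl
  constructor
  · have hac : μ.map (fun ω => a ω 0) ≪ volume := by
      rw [hmarg]
      exact withDensity_absolutelyContinuous _ _
    have hv : ∀ᵐ x : ℂ, x ≠ 0 := by simp [ae_iff]
    have hne : ∀ᵐ x ∂(μ.map fun ω => a ω 0), x ≠ 0 := hac.ae_le hv
    filter_upwards [ae_of_ae_map h0 hne] with ω hω
    ext z
    simp only [padePoles, mem_ofPred_eq, mem_singleton_iff, Matrix.det_unique, hankelOne,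
      hankelZero, Matrix.sub_apply, Matrix.smul_apply, Matrix.of_apply, smul_eq_mul]
    rw [eq_div_iff hω, sub_eq_zero, eq_comm]
    rfl
  · rw [← map_div_eq_withDensity_poleDensity hG hα hσ ξ
      (by rw [← hmarg]; exact Measure.isProbabilityMeasure_map h0)
      (by rw [← hmarg]; exact charFun_map_data_zero ha hσ hS), ← hlaw,
      AEMeasurable.map_map_of_aemeasurable (by fun_prop) h01]
    rfl

end Data

/-! ### First order expansion in the signal-to-noise ratio -/

theorem lineProj_sub_lineDist (ξ z : ℂ) :
    lineProj ξ z - lineDist ξ z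
      = (4 * inner ℝ z ξ + (1 - ‖z‖ ^ 2) * (1 - ‖ξ‖ ^ 2)) / (1 + ‖z‖ ^ 2) := by
  unfold lineDist lineProj
  rw [← sub_div]
  congr 1
  simp only [Complex.inner, Complex.sq_norm, Complex.normSq_apply, Complex.sub_re, Complex.sub_im,
    Complex.add_re, Complex.add_im, Complex.mul_re, Complex.mul_im, Complex.conj_re,
    Complex.conj_im, Complex.one_re, Complex.one_im]
  ring

theorem abs_lineProj_sub_lineDist_sub_le (ξ z : ℂ) :
    |lineProj ξ z - lineDist ξ z - 4 * inner ℝ z ξ / (1 + ‖z‖ ^ 2)| ≤ |1 - ‖ξ‖ ^ 2| := by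
  have hN : 0 < 1 + ‖z‖ ^ 2 := by positivity
  rw [lineProj_sub_lineDist, ← sub_div, add_sub_cancel_left, abs_div, abs_mul, abs_of_pos hN,
    div_le_iff₀ hN, mul_comm]
  gcongr
  rw [abs_le]
  constructor <;> nlinarith [sq_nonneg ‖z‖]

theorem abs_one_div_one_sub_sq_sub_le {ε : ℝ} (hε : |ε| ≤ 5 / 16) :
    |1 / (1 - ε) ^ 2 - (1 + 2 * ε)| ≤ 9 * ε ^ 2 := by
  obtain ⟨h1, h2⟩ := abs_le.1 hε
  have h0 : 0 < 1 - ε := by linarith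
  have hpos : 0 < (1 - ε) ^ 2 := by positivity
  have h : 1 / (1 - ε) ^ 2 - (1 + 2 * ε) = ε ^ 2 * (3 - 2 * ε) / (1 - ε) ^ 2 := by
    field_simp
    ring
  rw [h, abs_div, abs_of_pos hpos, div_le_iff₀ hpos, abs_mul, abs_of_nonneg (sq_nonneg ε),
    abs_of_pos (by linarith), mul_comm 9, mul_assoc]
  gcongr
  nlinarith

/-- The expansion of the spherical density in its centre `m`, up to second order terms that are
uniform in `z`. -/
theorem abs_sq_div_sq_sub_le {m : ℂ} (hm : ‖m‖ ≤ 1 / 4) (z : ℂ) :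
    |(1 + ‖z‖ ^ 2) ^ 2 / (1 + ‖z - m‖ ^ 2) ^ 2 - (1 + 4 * inner ℝ z m / (1 + ‖z‖ ^ 2))|
      ≤ 17 * ‖m‖ ^ 2 := by
  have hN : 0 < 1 + ‖z‖ ^ 2 := by positivity
  have hm0 := norm_nonneg m
  set ε : ℝ := (2 * inner ℝ z m - ‖m‖ ^ 2) / (1 + ‖z‖ ^ 2) with hε
  have hden : 1 + ‖z - m‖ ^ 2 = (1 + ‖z‖ ^ 2) * (1 - ε) := by
    rw [norm_sub_sq_real, hε]
    field_simp
    ring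
  have habs : |ε| ≤ 5 / 4 * ‖m‖ := by
    rw [hε, abs_div, abs_of_pos hN, div_le_iff₀ hN]
    have h1 := abs_le.1 (abs_real_inner_le_norm z m)
    have h2 : 2 * (‖z‖ * ‖m‖) ≤ ‖m‖ * (1 + ‖z‖ ^ 2) := by nlinarith [sq_nonneg (‖z‖ - 1)]
    have h3 : ‖m‖ ^ 2 ≤ 1 / 4 * ‖m‖ * (1 + ‖z‖ ^ 2) := by
      nlinarith [mul_nonneg hm0 (sq_nonneg ‖z‖)]
    rw [abs_le]
    constructor <;> nlinarith [h1.1, h1.2, sq_nonneg ‖m‖]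
  have hε2 : ε ^ 2 ≤ 25 / 16 * ‖m‖ ^ 2 := by
    rw [← sq_abs]
    calc |ε| ^ 2 ≤ (5 / 4 * ‖m‖) ^ 2 := by gcongr
      _ = _ := by ring
  have hmain := abs_one_div_one_sub_sq_sub_le (ε := ε) (by linarith)
  have hquot : (1 + ‖z‖ ^ 2) ^ 2 / (1 + ‖z - m‖ ^ 2) ^ 2 = 1 / (1 - ε) ^ 2 := by
    rw [hden, mul_pow, ← div_div, div_self (by positivity)]
  have hlin : 4 * inner ℝ z m / (1 + ‖z‖ ^ 2) = 2 * ε + 2 * (‖m‖ ^ 2 / (1 + ‖z‖ ^ 2)) := by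
    rw [hε]
    ring
  have hrest0 : 0 ≤ ‖m‖ ^ 2 / (1 + ‖z‖ ^ 2) := by positivity
  have hrest : ‖m‖ ^ 2 / (1 + ‖z‖ ^ 2) ≤ ‖m‖ ^ 2 :=
    div_le_self (by positivity) (by nlinarith [sq_nonneg ‖z‖])
  rw [hquot, hlin]
  rw [abs_le] at hmain ⊢
  constructor <;> linarith [hmain.1, hmain.2]

theorem abs_integral_sub_mul_le {q : ℝ → ℝ} (hq : Continuous q) {b L x : ℝ} (hL : 0 ≤ L)
    (hb : ∀ k, 0 ≤ k → |q k - b| ≤ L * k) (hx : 0 ≤ x) :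
    |(∫ l in (0 : ℝ)..x, q l) - b * x| ≤ L * x ^ 2 := by
  have h : (∫ l in (0 : ℝ)..x, q l) - b * x = ∫ l in (0 : ℝ)..x, (q l - b) := by
    rw [intervalIntegral.integral_sub (hq.intervalIntegrable _ _) (by simp)]
    simp [mul_comm]
  have h2 : ∀ l ∈ uIoc 0 x, ‖q l - b‖ ≤ L * x := by
    intro l hl
    rw [uIoc_of_le hx] at hl
    exact (hb l hl.1.le).trans (mul_le_mul_of_nonneg_left hl.2 hL)
  have h3 := intervalIntegral.norm_integral_le_of_norm_le_const h2
  rw [h, ← Real.norm_eq_abs]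
  calc _ ≤ L * x * |x - 0| := h3
    _ = _ := by rw [sub_zero, abs_of_nonneg hx]; ring

/-- The bracket of the pole density, up to second order in `ρ`. -/
theorem abs_pi_mul_sub_le {Γ L ρ D u I Q : ℝ} (hL : 0 ≤ L) (hρ : 0 ≤ ρ) (hD : 0 ≤ D) (hu : 0 ≤ u)
    (hB : D + u ≤ 5) (hI : |I - Γ / π * (ρ * D)| ≤ L * (ρ * D) ^ 2)
    (hQ : |Q - Γ / π| ≤ L * (ρ * D)) :
    |π * (1 / π - I + ρ * u * Q) - (1 + ρ * Γ * (u - D))| ≤ 25 * π * L * ρ ^ 2 := by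
  have hπ := Real.pi_pos
  have h1 : π * (1 / π - I + ρ * u * Q) - (1 + ρ * Γ * (u - D))
      = π * (-(I - Γ / π * (ρ * D)) + ρ * u * (Q - Γ / π)) := by
    field_simp
    ring
  have h2 : |ρ * u * (Q - Γ / π)| ≤ ρ * u * (L * (ρ * D)) := by
    rw [abs_mul, abs_of_nonneg (by positivity)]
    gcongr
  have h3 : D * (D + u) ≤ 25 := by nlinarith
  rw [h1, abs_mul, abs_of_pos hπ]
  calc _ ≤ π * (L * (ρ * D) ^ 2 + ρ * u * (L * (ρ * D))) := by
        gcongr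
        refine (abs_add_le _ _).trans ?_
        rw [abs_neg]
        exact add_le_add hI h2
    _ = π * L * ρ ^ 2 * (D * (D + u)) := by ring
    _ ≤ π * L * ρ ^ 2 * 25 := by gcongr
    _ = _ := by ring

/-- The spherical density with centre `ρ Γ ξ`, up to second order terms in `ρ` and `|ξ| - 1`. -/
theorem abs_sq_div_sq_sub_one_add_le {Γ ρ : ℝ} (hΓ : 0 ≤ Γ) (hρ : 0 ≤ ρ) (hρΓ : ρ * Γ ≤ 1 / 8)
    {ξ : ℂ} (hξ : ‖ξ‖ ≤ 2) (z : ℂ) :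
    |(1 + ‖z‖ ^ 2) ^ 2 / (1 + ‖z - ((ρ * Γ : ℝ) : ℂ) * ξ‖ ^ 2) ^ 2
        - (1 + ρ * Γ * (lineProj ξ z - lineDist ξ z))|
      ≤ 68 * Γ ^ 2 * ρ ^ 2 + 3 * Γ * (ρ * |‖ξ‖ - 1|) := by
  have hlin := abs_lineProj_sub_lineDist_sub_le ξ z
  generalize lineProj ξ z - lineDist ξ z = w at hlin ⊢
  have hmnorm : ‖((ρ * Γ : ℝ) : ℂ) * ξ‖ = ρ * Γ * ‖ξ‖ := by
    rw [norm_mul, Complex.norm_real, Real.norm_of_nonneg (by positivity)]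
  -- the two bounds on `ρ` and `ξ` keep the centre in the range of the expansion
  have hm4 : ‖((ρ * Γ : ℝ) : ℂ) * ξ‖ ≤ 1 / 4 := by
    rw [hmnorm]
    calc ρ * Γ * ‖ξ‖ ≤ 1 / 8 * 2 := by gcongr
      _ = 1 / 4 := by norm_num
  have hm2 : 17 * ‖((ρ * Γ : ℝ) : ℂ) * ξ‖ ^ 2 ≤ 68 * Γ ^ 2 * ρ ^ 2 := by
    rw [hmnorm]
    calc 17 * (ρ * Γ * ‖ξ‖) ^ 2 ≤ 17 * (ρ * Γ * 2) ^ 2 := by gcongr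
      _ = _ := by ring
  have hsph := (abs_sq_div_sq_sub_le hm4 z).trans hm2
  rw [← Complex.real_smul, real_inner_smul_right, Complex.real_smul] at hsph
  have hξ1 : |1 - ‖ξ‖ ^ 2| ≤ 3 * |‖ξ‖ - 1| := by
    rw [show 1 - ‖ξ‖ ^ 2 = -((1 + ‖ξ‖) * (‖ξ‖ - 1)) by ring, abs_neg, abs_mul,
      abs_of_pos (by positivity)]
    gcongr
    linarith
  have hlin' : |4 * (ρ * Γ * inner ℝ z ξ) / (1 + ‖z‖ ^ 2) - ρ * Γ * w|
      ≤ 3 * Γ * (ρ * |‖ξ‖ - 1|) := by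
    rw [show 4 * (ρ * Γ * inner ℝ z ξ) / (1 + ‖z‖ ^ 2) - ρ * Γ * w
      = ρ * Γ * -(w - 4 * inner ℝ z ξ / (1 + ‖z‖ ^ 2)) by ring, abs_mul, abs_neg,
      abs_of_nonneg (by positivity)]
    calc _ ≤ ρ * Γ * (3 * |‖ξ‖ - 1|) := by gcongr; exact hlin.trans hξ1
      _ = _ := by ring
  have h := abs_add_le _ _ |>.trans (add_le_add hsph hlin')
  rwa [sub_add_eq_sub_sub, sub_add_sub_cancel, ← sub_add_eq_sub_sub] at h

theorem exists_abs_poleDensity_sub_sphericalApprox_le {α : ℝ} (hα : 0 < α) :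
    ∃ C : ℝ, ∀ ρ : ℝ, 0 ≤ ρ → ρ * Real.Gamma (1 + 2 / α) ≤ 1 / 8 → ∀ ξ : ℂ, ‖ξ‖ ≤ 2 → ∀ z : ℂ,
      |poleDensity α ρ ξ z - sphericalApprox α ρ ξ z| ≤ C * (ρ * (ρ + |‖ξ‖ - 1|)) := by
  obtain ⟨L, hL, hq⟩ := exists_abs_stablePlanarDensity_sub_le hα
  have hΓ : 0 < Real.Gamma (1 + 2 / α) := Real.Gamma_pos_of_pos (by positivity)
  refine ⟨25 * π * L + 68 * Real.Gamma (1 + 2 / α) ^ 2 + 3 * Real.Gamma (1 + 2 / α),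
    fun ρ hρ hρΓ ξ hξ z => ?_⟩
  have hπ := Real.pi_pos
  have hD := lineDist_nonneg ξ z
  have hu := lineProj_nonneg ξ z
  have hB : lineDist ξ z + lineProj ξ z ≤ 5 := by
    rw [lineDist_add_lineProj]
    nlinarith [norm_nonneg ξ]
  have hbr := abs_pi_mul_sub_le hL hρ hD hu hB
    (abs_integral_sub_mul_le (continuous_stablePlanarDensity hα) hL hq (by positivity))
    (hq (ρ * lineDist ξ z) (by positivity))
  have hsph := abs_sq_div_sq_sub_one_add_le hΓ.le hρ hρΓ hξ z
  have hsa0 : 0 ≤ sphericalApprox α ρ ξ z := by unfold sphericalApprox; positivity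
  have hsa : sphericalApprox α ρ ξ z = ((1 + ‖z‖ ^ 2) ^ 2)⁻¹ * (1 / π *
      ((1 + ‖z‖ ^ 2) ^ 2
        / (1 + ‖z - ((ρ * Real.Gamma (1 + 2 / α) : ℝ) : ℂ) * ξ‖ ^ 2) ^ 2)) := by
    rw [sphericalApprox]
    have hN : 1 + ‖z‖ ^ 2 ≠ 0 := by positivity
    field_simp
  rw [poleDensity]
  generalize 1 / π - (∫ l in (0 : ℝ)..(ρ * lineDist ξ z), stablePlanarDensity α l)
    + ρ * lineProj ξ z * stablePlanarDensity α (ρ * lineDist ξ z) = b at hbr ⊢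
  generalize Real.Gamma (1 + 2 / α) = Γ at *
  generalize lineProj ξ z - lineDist ξ z = w at hbr hsph
  have hmax := abs_max_sub_max_le_abs (((1 + ‖z‖ ^ 2) ^ 2)⁻¹ * b) (sphericalApprox α ρ ξ z) 0
  rw [max_eq_left hsa0, max_comm, hsa] at hmax
  rw [hsa]
  generalize (1 + ‖z‖ ^ 2) ^ 2 / (1 + ‖z - ((ρ * Γ : ℝ) : ℂ) * ξ‖ ^ 2) ^ 2 = v at hmax hsph ⊢
  have hinv : ((1 + ‖z‖ ^ 2) ^ 2)⁻¹ * (1 / π) ≤ 1 := by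
    have h1 : ((1 + ‖z‖ ^ 2) ^ 2)⁻¹ ≤ 1 :=
      inv_le_one_of_one_le₀ (one_le_pow₀ (by linarith [sq_nonneg ‖z‖]))
    have h2 : 1 / π ≤ 1 := (div_le_one hπ).2 (by linarith [Real.pi_gt_three])
    exact mul_le_one₀ h1 (by positivity) h2
  refine hmax.trans ?_
  have hfac : ((1 + ‖z‖ ^ 2) ^ 2)⁻¹ * b - ((1 + ‖z‖ ^ 2) ^ 2)⁻¹ * (1 / π * v)
      = ((1 + ‖z‖ ^ 2) ^ 2)⁻¹ * (1 / π) * (π * b - v) := by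
    field_simp
  rw [hfac, abs_mul, abs_of_nonneg (by positivity)]
  refine (mul_le_of_le_one_left (abs_nonneg _) hinv).trans ?_
  rw [abs_sub_comm] at hsph
  refine (abs_sub_le _ (1 + ρ * Γ * w) _).trans ((add_le_add hbr hsph).trans ?_)
  calc _ ≤ 25 * π * L * ρ ^ 2 + (68 * Γ ^ 2 * ρ ^ 2 + 3 * Γ * (ρ * |‖ξ‖ - 1|))
        + ((25 * π * L + 68 * Γ ^ 2) * (ρ * |‖ξ‖ - 1|) + 3 * Γ * ρ ^ 2) :=
      le_add_of_nonneg_right (by positivity)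
    _ = _ := by ring

theorem exists_eventually_abs_poleDensity_sub_sphericalApprox_le {α : ℝ} (hα : 0 < α) :
    ∃ C : ℝ, ∀ᶠ q : ℝ × ℂ in 𝓝[≥] (0 : ℝ) ×ˢ comap (fun ξ : ℂ => ‖ξ‖) (𝓝 1),
      ∀ z : ℂ, |poleDensity α q.1 q.2 z - sphericalApprox α q.1 q.2 z|
        ≤ C * (q.1 * (q.1 + |‖q.2‖ - 1|)) := by
  obtain ⟨C, hC⟩ := exists_abs_poleDensity_sub_sphericalApprox_le hα
  refine ⟨C, ?_⟩
  have hΓ : 0 < Real.Gamma (1 + 2 / α) := Real.Gamma_pos_of_pos (by positivity)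
  have h1 : ∀ᶠ ρ : ℝ in 𝓝[≥] (0 : ℝ), 0 ≤ ρ ∧ ρ * Real.Gamma (1 + 2 / α) ≤ 1 / 8 := by
    have : ∀ᶠ ρ : ℝ in 𝓝[≥] (0 : ℝ), ρ < 1 / 8 / Real.Gamma (1 + 2 / α) :=
      eventually_nhdsWithin_of_eventually_nhds (eventually_lt_nhds (by positivity))
    filter_upwards [this, self_mem_nhdsWithin] with ρ h h0
    exact ⟨h0, ((lt_div_iff₀ hΓ).1 h).le⟩
  have h2 : ∀ᶠ ξ : ℂ in comap (fun ξ : ℂ => ‖ξ‖) (𝓝 1), ‖ξ‖ ≤ 2 :=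
    tendsto_comap.eventually (eventually_le_nhds (by norm_num))
  filter_upwards [h1.prod_mk h2] with q hq
  exact hC q.1 hq.1.1 hq.1.2 q.2 hq.2

/-! ### The radial function `1 / (1 + r²)²` -/

theorem sqrt_poleRadial (r : ℝ) : √(poleRadial r) = (1 + r ^ 2)⁻¹ := by
  rw [poleRadial, one_div, ← inv_pow, Real.sqrt_sq (by positivity)]

theorem hasDerivAt_inv_one_add_sq (r : ℝ) :
    HasDerivAt (fun r : ℝ => (1 + r ^ 2)⁻¹) (-(2 * r) / (1 + r ^ 2) ^ 2) r := by
  have h : HasDerivAt (fun r : ℝ => 1 + r ^ 2) (2 * r) r := by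
    simpa using (hasDerivAt_pow 2 r).const_add 1
  exact h.inv (by positivity)

theorem hasDerivAt_sqrt_poleRadial (r : ℝ) :
    HasDerivAt (fun r => √(poleRadial r)) (-(2 * r) / (1 + r ^ 2) ^ 2) r := by
  simpa only [sqrt_poleRadial] using hasDerivAt_inv_one_add_sq r

theorem deriv_sqrt_poleRadial :
    (deriv fun r => √(poleRadial r)) = fun r => -(2 * r) / (1 + r ^ 2) ^ 2 :=
  funext fun r => (hasDerivAt_sqrt_poleRadial r).deriv

theorem continuous_poleRadial : Continuous poleRadial := by
  unfold poleRadial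
  exact Continuous.div (by fun_prop) (by fun_prop) fun r => by positivity

theorem hasDerivAt_primitive_poleRadial (r : ℝ) :
    HasDerivAt (fun r : ℝ => -(1 / 2) * (1 + r ^ 2)⁻¹) (r ^ 1 * poleRadial r) r := by
  have h := (hasDerivAt_inv_one_add_sq r).const_mul (-(1 / 2))
  have he : -(1 / 2) * (-(2 * r) / (1 + r ^ 2) ^ 2) = r ^ 1 * poleRadial r := by
    rw [poleRadial]
    ring
  rwa [he] at h

theorem tendsto_primitive_poleRadial :
    Tendsto (fun r : ℝ => -(1 / 2) * (1 + r ^ 2)⁻¹) atTop (𝓝 0) := by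
  have h : Tendsto (fun r : ℝ => 1 + r ^ 2) atTop atTop :=
    tendsto_atTop_add_const_left _ _ (tendsto_pow_atTop two_ne_zero)
  simpa using h.inv_tendsto_atTop.const_mul (-(1 / 2) : ℝ)

theorem mul_poleRadial_nonneg {r : ℝ} (hr : r ∈ Ioi 0) : 0 ≤ r ^ 1 * poleRadial r := by
  have hr' : (0 : ℝ) < r := hr
  unfold poleRadial
  positivity

theorem integrableOn_mul_poleRadial : IntegrableOn (fun r => r ^ 1 * poleRadial r) (Ioi 0) :=
  integrableOn_Ioi_deriv_of_nonneg' (fun r _ => hasDerivAt_primitive_poleRadial r)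
    (fun _ hr => mul_poleRadial_nonneg hr) tendsto_primitive_poleRadial

theorem radialMoment_poleRadial : radialMoment 1 poleRadial = 1 / 2 := by
  rw [radialMoment, integral_Ioi_of_hasDerivAt_of_nonneg'
    (fun r _ => hasDerivAt_primitive_poleRadial r)
    (fun _ hr => mul_poleRadial_nonneg hr) tendsto_primitive_poleRadial]
  norm_num

/-- Square integrability for the weight `r` of functions dominated by a multiple of
`1 / (1 + r²)`. -/
theorem memLp_two_weightedMeasure_one {u : ℝ → ℝ} (hu : Continuous u) {B : ℝ}
    (hB : ∀ r, u r ^ 2 ≤ B * poleRadial r) : MemLp u 2 (weightedMeasure 1) := by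
  have hm : Measurable fun r : ℝ => ENNReal.ofReal (r ^ 1) := by fun_prop
  rw [memLp_two_iff_integrable_sq hu.aestronglyMeasurable, weightedMeasure,
    integrable_withDensity_iff hm (Eventually.of_forall fun _ => ENNReal.ofReal_lt_top)]
  refine (integrableOn_mul_poleRadial.const_mul B).mono'
    (by have := hu.measurable; fun_prop) ((ae_restrict_iff' measurableSet_Ioi).2
      (Eventually.of_forall fun r hr => ?_))
  have hr' : (0 : ℝ) < r := hr
  rw [ENNReal.toReal_ofReal (by positivity), Real.norm_of_nonneg (by positivity)]
  calc u r ^ 2 * r ^ 1 ≤ B * poleRadial r * r ^ 1 := by gcongr; exact hB r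
    _ = _ := by ring

theorem continuous_sqrt_poleRadial_deriv :
    Continuous fun r : ℝ => -(2 * r) / (1 + r ^ 2) ^ 2 :=
  Continuous.div (by fun_prop) (by fun_prop) fun r => by positivity

theorem memLp_sqrt_poleRadial_deriv :
    MemLp (fun r : ℝ => -(2 * r) / (1 + r ^ 2) ^ 2) 2 (weightedMeasure 1) := by
  refine memLp_two_weightedMeasure_one continuous_sqrt_poleRadial_deriv (B := 4) fun r => ?_
  rw [poleRadial, div_pow, mul_one_div, div_le_div_iff₀ (by positivity) (by positivity)]
  have h : r ^ 2 ≤ (1 + r ^ 2) ^ 2 := by nlinarith [sq_nonneg (r ^ 2), sq_nonneg r]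
  nlinarith [mul_le_mul_of_nonneg_right h (show 0 ≤ (1 + r ^ 2) ^ 2 by positivity)]

theorem memLp_sqrt_poleRadial : MemLp (fun r => √(poleRadial r)) 2 (weightedMeasure 1) := by
  refine memLp_two_weightedMeasure_one continuous_poleRadial.sqrt (B := 1) fun r => ?_
  rw [Real.sq_sqrt (by unfold poleRadial; positivity), one_mul]

theorem isWeakDerivOnPos_sqrt_poleRadial :
    IsWeakDerivOnPos (fun r => √(poleRadial r)) fun r => -(2 * r) / (1 + r ^ 2) ^ 2 := by
  intro ψ hψ hc hs
  have hψ1 : Continuous (deriv ψ) := hψ.continuous_deriv (by simp)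
  have hzero : ∀ r, r ∉ Ioi (0 : ℝ) → ψ r = 0 := fun r hr =>
    image_eq_zero_of_notMem_tsupport fun h => hr (hs h)
  have hzero' : ∀ r, r ∉ Ioi (0 : ℝ) → deriv ψ r = 0 := fun r hr =>
    image_eq_zero_of_notMem_tsupport fun h => hr (hs (tsupport_deriv_subset (f := ψ) h))
  have hu : Continuous fun r => √(poleRadial r) := continuous_poleRadial.sqrt
  rw [setIntegral_eq_integral_of_forall_compl_eq_zero fun r hr => by rw [hzero' r hr, mul_zero],
    setIntegral_eq_integral_of_forall_compl_eq_zero fun r hr => by rw [hzero r hr, mul_zero]]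
  refine integral_mul_deriv_eq_deriv_mul_of_integrable
    (fun r _ => hasDerivAt_sqrt_poleRadial r)
    (fun r _ => (hψ.differentiable (by simp) r).hasDerivAt) ?_ ?_ ?_
  · exact (hu.mul hψ1).integrable_of_hasCompactSupport hc.deriv.mul_left
  · exact (continuous_sqrt_poleRadial_deriv.mul hψ.continuous).integrable_of_hasCompactSupport
      hc.mul_left
  · exact (hu.mul hψ.continuous).integrable_of_hasCompactSupport hc.mul_left

theorem assumptionA1_poleRadial : AssumptionA1 2 poleRadial :=
  ⟨Eventually.of_forall fun r => by unfold poleRadial; positivity, integrableOn_mul_poleRadial⟩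

theorem assumptionA2'_poleRadial : AssumptionA2' 2 poleRadial :=
  ⟨memLp_sqrt_poleRadial, _, isWeakDerivOnPos_sqrt_poleRadial, memLp_sqrt_poleRadial_deriv⟩

/-! ### The spherical density as an elliptical density -/

theorem distanceDensity_poleRadial (r : ℝ) :
    distanceDensity 2 poleRadial r = 2 * r / (1 + r ^ 2) ^ 2 := by
  rw [distanceDensity, show 2 - 1 = 1 from rfl, radialMoment_poleRadial, poleRadial]
  ring

theorem measurable_distanceDensity_poleRadial : Measurable (distanceDensity 2 poleRadial) := by
  have : distanceDensity 2 poleRadial = fun r => 2 * r / (1 + r ^ 2) ^ 2 :=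
    funext distanceDensity_poleRadial
  rw [this]
  fun_prop

theorem sphericalDensity_distanceDensity_poleRadial {y : ℝ} (hy : 0 < y) :
    sphericalDensity (Fin 1 ⊕ Fin 1) 1 (distanceDensity 2 poleRadial) y
      = ENNReal.ofReal (1 / (π * (1 + y) ^ 2)) := by
  have hs : √y ≠ 0 := (Real.sqrt_pos.2 hy).ne'
  rw [sphericalDensity, distanceDensity_poleRadial, one_smul, Matrix.det_one, Real.sqrt_one]
  simp only [Fintype.card_sum, Fintype.card_fin, inv_one, one_mul, Real.sq_sqrt hy.le]
  norm_num
  congr 1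
  field_simp

/-- The vector `reIm` of a single complex number, as a measurable equivalence. -/
def reImEquivOne : ℂ ≃ᵐ EuclideanSpace ℝ (Fin 1 ⊕ Fin 1) :=
  (MeasurableEquiv.funUnique (Fin 1) ℂ).symm.trans (reImEquiv 1)

theorem coe_reImEquivOne : ⇑reImEquivOne = fun z => reIm fun _ : Fin 1 => z := by
  funext z
  rw [reImEquivOne, MeasurableEquiv.coe_trans, coe_reImEquiv]
  rfl

theorem measurePreserving_reImEquivOne : MeasurePreserving reImEquivOne := by
  have h := measurePreserving_reIm 1
  rw [← coe_reImEquiv] at h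
  exact h.comp (volume_preserving_funUnique (Fin 1) ℂ).symm

theorem map_norm_sub_withDensity {F : ℝ → ENNReal} (hF : Measurable F) (m : ℂ) :
    ((volume : Measure ℂ).withDensity fun z => F ‖z - m‖).map (fun z => ‖z - m‖)
      = (volume.restrict (Ioi 0)).withDensity
        fun r => ENNReal.ofReal (2 * π) * (ENNReal.ofReal r * F r) := by
  have hn : Measurable fun z : ℂ => ‖z - m‖ := by fun_prop
  ext s hs
  rw [Measure.map_apply hn hs, withDensity_apply _ (hn hs), withDensity_apply _ hs,
    ← lintegral_indicator (hn hs), ← lintegral_indicator hs]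
  have h := lintegral_comp_norm (hF.indicator hs)
  rw [← lintegral_sub_right_eq_self (fun v : ℂ => s.indicator F ‖v‖) m, ← lintegral_const_mul _
    (by have := hF.indicator hs; fun_prop)] at h
  refine Eq.trans (lintegral_congr fun z => ?_) (h.trans (lintegral_congr fun r => ?_))
  · rfl
  · by_cases hr : r ∈ s <;> simp [hr]

theorem isElliptical_sphericalApprox (α ρ : ℝ) (ξ : ℂ) :
    IsElliptical (reIm fun _ : Fin 1 => ((ρ * Real.Gamma (1 + 2 / α) : ℝ) : ℂ) * ξ)
      (1 : Matrix (Fin 1 ⊕ Fin 1) (Fin 1 ⊕ Fin 1) ℝ) (distanceDensity 2 poleRadial)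
      ((volume.withDensity fun z : ℂ => ENNReal.ofReal (sphericalApprox α ρ ξ z)).map
        fun z => reIm fun _ : Fin 1 => z) := by
  set m : ℂ := ((ρ * Real.Gamma (1 + 2 / α) : ℝ) : ℂ) * ξ with hm
  set s : EuclideanSpace ℝ (Fin 1 ⊕ Fin 1) := reIm fun _ : Fin 1 => m with hs
  have hnorm : ∀ z : ℂ, ‖reImEquivOne z - s‖ ^ 2 = ‖z - m‖ ^ 2 := fun z => by
    rw [coe_reImEquivOne, hs, norm_reIm_sub_sq, Fin.sum_univ_one]
  have hmah : ∀ x, mahalanobis s (1 : Matrix (Fin 1 ⊕ Fin 1) (Fin 1 ⊕ Fin 1) ℝ) x = ‖x - s‖ := by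
    intro x
    rw [← one_smul ℝ (1 : Matrix (Fin 1 ⊕ Fin 1) (Fin 1 ⊕ Fin 1) ℝ),
      mahalanobis_smul_one one_ne_zero, inv_one, one_mul, Real.sqrt_sq (norm_nonneg _)]
  rw [← coe_reImEquivOne]
  refine ⟨Matrix.PosDef.one, measurable_distanceDensity_poleRadial, fun r hr => ?_, ?_, ?_⟩
  · rw [distanceDensity_poleRadial]
    positivity
  · rw [funext hmah, Measure.map_map (by fun_prop) reImEquivOne.measurable]
    have hcomp : (fun x => ‖x - s‖) ∘ reImEquivOne = fun z => ‖z - m‖ := by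
      funext z
      exact (pow_left_inj₀ (norm_nonneg _) (norm_nonneg _) two_ne_zero).1 (hnorm z)
    rw [hcomp]
    have h := map_norm_sub_withDensity (F := fun r => ENNReal.ofReal (1 / (π * (1 + r ^ 2) ^ 2)))
      (by fun_prop) m
    refine h.trans (withDensity_congr_ae ((ae_restrict_iff' measurableSet_Ioi).2
      (Eventually.of_forall fun r hr => ?_)))
    have hr' : (0 : ℝ) < r := hr
    simp only
    rw [distanceDensity_poleRadial, ← ENNReal.ofReal_mul hr'.le,
      ← ENNReal.ofReal_mul (by positivity)]
    congr 1
    field_simp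
  · rw [← map_withDensity_of_measurePreserving reImEquivOne measurePreserving_reImEquivOne]
    congr 1
    refine withDensity_congr_ae ?_
    -- at the centre `ellipticalDensity` takes the junk value `0`, as `0⁻¹ = 0`
    have hne : ∀ᵐ z : ℂ, z ≠ m := by simp [ae_iff]
    filter_upwards [hne] with z hz
    rw [← one_smul ℝ (1 : Matrix (Fin 1 ⊕ Fin 1) (Fin 1 ⊕ Fin 1) ℝ),
      ofReal_ellipticalDensity_smul_one one_ne_zero, hnorm,
      sphericalDensity_distanceDensity_poleRadial
        (by have := norm_pos_iff.2 (sub_ne_zero.2 hz); positivity)]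
    rfl

end

theorem theorem4 (α : ℝ) (hα : 0 < α) (hα2 : α ≤ 2) :
    -- the pole density `h ρ ξ`, and its approximation as `ρ → 0` and `|ξ| → 1`
    (∃ h : ℝ → ℂ → ℂ → ℝ,
      (∀ ρ : ℝ, 0 ≤ ρ → ∀ ξ : ℂ, Continuous (h ρ ξ) ∧ ∀ z, 0 ≤ h ρ ξ z) ∧
      (∀ (Ω : Type*) [MeasurableSpace Ω] (μ : Measure Ω) [IsProbabilityMeasure μ]
        (a : Ω → Fin 2 → ℂ) (c ξ : ℂ) (σ : ℝ) (g : ℝ → ℝ), AEMeasurable a μ → 0 < σ →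
        IsElliptical (reIm fun k : Fin 2 => c * ξ ^ (k : ℕ))
          ((σ ^ 2 / 2) • (1 : Matrix (Fin 2 ⊕ Fin 2) (Fin 2 ⊕ Fin 2) ℝ)) g
          (μ.map fun ω => reIm (a ω)) →
        IsStable α (reIm fun k : Fin 2 => c * ξ ^ (k : ℕ))
          ((σ ^ 2 / 2) • (1 : Matrix (Fin 2 ⊕ Fin 2) (Fin 2 ⊕ Fin 2) ℝ))
          (μ.map fun ω => reIm (a ω)) →
        (∀ᵐ ω ∂μ, padePoles (p := 1) (a ω) = {a ω 1 / a ω 0}) ∧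
        μ.map (fun ω => a ω 1 / a ω 0)
          = volume.withDensity (fun z => ENNReal.ofReal (h (‖c‖ ^ 2 / σ ^ 2) ξ z))) ∧
      (∃ C : ℝ, ∀ᶠ q : ℝ × ℂ in 𝓝[≥] (0 : ℝ) ×ˢ comap (fun ξ : ℂ => ‖ξ‖) (𝓝 1),
        ∀ z : ℂ, |h q.1 q.2 z - sphericalApprox α q.1 q.2 z|
          ≤ C * (q.1 * (q.1 + |‖q.2‖ - 1|)))) ∧
    -- the approximating density is spherical, with radial function `f(r) = 1/(1+r²)²`
    (∀ (ρ : ℝ) (ξ : ℂ),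
      IsElliptical (reIm fun _ : Fin 1 => ((ρ * Real.Gamma (1 + 2 / α) : ℝ) : ℂ) * ξ)
        (1 : Matrix (Fin 1 ⊕ Fin 1) (Fin 1 ⊕ Fin 1) ℝ) (distanceDensity 2 poleRadial)
        ((volume.withDensity fun z : ℂ => ENNReal.ofReal (sphericalApprox α ρ ξ z)).map
          fun z => reIm fun _ : Fin 1 => z)) ∧
    -- the first moment of the radial function
    IntegrableOn (fun r => r ^ 1 * poleRadial r) (Ioi 0) ∧
    radialMoment 1 poleRadial = 1 / 2 ∧
    -- the derivative of its square root
    Differentiable ℝ (fun r => Real.sqrt (poleRadial r)) ∧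
    MemLp (deriv fun r => Real.sqrt (poleRadial r)) 2 (weightedMeasure 1) ∧
    AssumptionA1 2 poleRadial ∧
    AssumptionA2' 2 poleRadial := by
  refine ⟨⟨poleDensity α,
      fun ρ _ ξ => ⟨continuous_poleDensity hα ρ ξ, poleDensity_nonneg α ρ ξ⟩,
      fun Ω _ μ _ a c ξ σ g ha hσ hE hS => ae_padePoles_eq_and_map_div_eq ha hα hσ hE hS,
      exists_eventually_abs_poleDensity_sub_sphericalApprox_le hα⟩,
    isElliptical_sphericalApprox α, integrableOn_mul_poleRadial, radialMoment_poleRadial,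
    fun r => (hasDerivAt_sqrt_poleRadial r).differentiableAt, ?_, assumptionA1_poleRadial,
    assumptionA2'_poleRadial⟩
  rw [deriv_sqrt_poleRadial]
  exact memLp_sqrt_poleRadial_deriv
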